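/- Let $p$ be a prime with $5\le p\le 19$, let $\Gamma_0(p)=\{\gamma=\begin{pmatrix}\gamma_{11}&\gamma_{12}\\ \gamma_{21}&\gamma_{22}\end{pmatrix}\in SL(2,\mathbb Z): p\mid\gamma_{21}\}$, and for $\gamma\in\Gamma_0(p)$ and a function $f$ on the upper half plane put $\langle\gamma\rangle(f)(\tau)=(\gamma_{21}\tau+\gamma_{22})^{-1}f(\gamma\tau)$ (the diamond operator in weight one). Let $q=e^{2\pi i\tau}$, $(a_1,\dots,a_r;q)_\infty=\prod_{j}\prod_{n\ge 0}(1-a_jq^n)$, and let $[d]$ denote the class of $d$ in $(\mathbb Z/p\mathbb Z)^*/\{\pm1\}$. Put $$\mathcal E_p(\tau)=\frac{2}{p-1}\sum_{\chi}E_{1,\chi}(\tau),\qquad E_{1,\chi}(\tau)=1+\frac{2}{L(0,\chi)}\sum_{n=1}^\infty\chi(n)\frac{q^n}{1-q^n},$$ where $\chi$ runs over the odd primitive Dirichlet characters modulo $p$ and $L(s,\chi)$ is the analytically continued $L$-function. Say that a family of functions $f_1,\dots,f_{(p-1)/2}$ is *permuted up to sign with permutation representation $(\mathbb Z/p\mathbb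 Z)^*/\{\pm1\}$* if there is a homomorphism $\rho$ from $\Gamma_0(p)$ to the permutations of $\{1,\dots,(p-1)/2\}$ such that, for all $\gamma,i,j$, one has $\langle\gamma\rangle(f_i)=\pm f_j$ if and only if $j=\rho(\gamma)(i)$; such that $\rho(\gamma)\mapsto[\gamma_{22}]$ is a well-defined isomorphism from the image of $\rho$ onto $(\mathbb Z/p\mathbb Z)^*/\{\pm1\}$; and such that some bijection $c:\{1,\dots,(p-1)/2\}\to(\mathbb Z/p\mathbb Z)^*/\{\pm1\}$ satisfies $c(\rho(\gamma)(i))=[\gamma_{22}]\,c(i)$ for all $\gamma,i$. **(1)** For $\gamma\in\Gamma_0(p)$ the function $\langle\gamma\rangle(\mathcal E_p)$ depends only on $\gamma_{22}$ modulo $p$; denote it by $\langle\gamma_{22}\rangle(\mathcal E_p)$. If $a_1,\dots,a_{(p-1)/2}\in(\mathbb Z/p\mathbb Z)^*$ have distinct classes in $(\mathbb Z/p\mathbb Z)^*/\{\pm1\}$, then the functions $\langle a_1\rangle(\mathcal E_p),\dots,\langle a_{(p-1)/2}\rangle(\mathcal E_p)$ are permuted up to sign with permutation representation $(\mathbb Z/p\mathbb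 Z)^*/\{\pm1\}$, and one may take $c(k)=[a_k]$. **(2)** The following theta quotients of level $p$ are permuted up to sign with permutation representation $(\mathbb Z/p\mathbb Z)^*/\{\pm1\}$. * $p=5$: $\;q\dfrac{(q;q)_\infty^2}{(q^2,q^3;q^5)_\infty^5},\ \dfrac{(q;q)_\infty^2}{(q,q^4;q^5)_\infty^5}$. * $p=7$: $\;q\dfrac{(q^2,q^5,q^7,q^7;q^7)_\infty}{(q^3,q^4;q^7)_\infty^2},\ -q\dfrac{(q,q^6,q^7,q^7;q^7)_\infty}{(q^2,q^5;q^7)_\infty^2},\ \dfrac{(q^3,q^4,q^7,q^7;q^7)_\infty}{(q,q^6;q^7)_\infty^2}$. * $p\ge 11$: write $\{m_1,\dots,m_s\mid n_1,\dots,n_t\}_e$ for $q^e(q^p;q^p)_\infty^2\,\dfrac{\prod_{i}(q^{m_i},q^{p-m_i};q^p)_\infty}{\prod_{j}(q^{n_j},q^{p-n_j};q^p)_\infty}$. Then * $p=11$: $\{4\mid1,2\}_0,\ \{5\mid3,4\}_1,\ \{1\mid3,5\}_2,\ \{3\mid2,4\}_1,\ \{2\mid5,1\}_1$; * $p=13$: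 $\{6\mid1,3\}_0,\ \{5\mid3,4\}_1,\ \{2\mid1,4\}_1,\ \{4\mid2,5\}_1,\ \{3\mid5,6\}_2,\ \{1\mid2,6\}_2$; * $p=17$: $\{8\mid2,3\}_0,\ \{5\mid3,4\}_1,\ \{1\mid4,6\}_3,\ \{7\mid6,8\}_2,\ \{2\mid5,8\}_3,\ \{3\mid1,5\}_1,\ \{4\mid1,7\}_1,\ \{6\mid2,7\}_1$; * $p=19$: $\{8,9\mid3,4,5\}_0,\ \{2,7\mid1,4,6\}_1,\ \{3,9\mid1,5,8\}_1,\ \{4,7\mid2,5,6\}_1,\ \{1,3\mid6,8,9\}_5,\ \{4,5\mid2,7,8\}_2,\ \{1,6\mid2,3,9\}_2,\ \{5,8\mid4,7,9\}_2,\ \{2,6\mid1,3,7\}_1$. -/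

import Mathlib

open scoped MatrixGroups ModularForm UpperHalfPlane

noncomputable section

/-- The nome `q = exp (2 π i τ)`. -/
def nome (τ : ℍ) : ℂ := Complex.exp (2 * Real.pi * Complex.I * (τ : ℂ))

/-- The weight `k` Eisenstein series
`E_{k,χ} = 1 + 2 / L(1 - k, χ) * ∑_{n ≥ 1} χ(n) n^(k-1) q^n / (1 - q^n)`, where `L(s, χ)` is the
analytically continued Dirichlet `L`-function. -/
def twistedEisenstein {N : ℕ} [NeZero N] (k : ℕ) (χ : DirichletCharacter ℂ N) (τ : ℍ) : ℂ :=
  1 + 2 / DirichletCharacter.LFunction χ (1 - (k : ℂ)) *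
    ∑' n : ℕ+, χ ((n : ℕ) : ZMod N) * (((n : ℕ) : ℂ) ^ (k - 1) * nome τ ^ (n : ℕ)
      / (1 - nome τ ^ (n : ℕ)))

open Classical in
/-- `𝓔_p = 2 / (p - 1) * ∑ E_{1,χ}`, over the odd primitive Dirichlet characters modulo `p`. -/
def eisensteinSum (p : ℕ) [NeZero p] (τ : ℍ) : ℂ :=
  2 / ((p : ℂ) - 1) *
    ∑ χ ∈ (Finset.univ : Finset (DirichletCharacter ℂ p)).filter
      (fun χ => χ.Odd ∧ χ.IsPrimitive), twistedEisenstein 1 χ τ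

/-- For `l = [r₁, …, r_m]`, the product `(q^{r₁}, …, q^{r_m}; q^N)_∞`, that is
`∏_i ∏_{n ≥ 0} (1 - q^(r_i + N n))`. -/
def qProd (l : List ℕ) (N : ℕ) (τ : ℍ) : ℂ :=
  (l.map fun r => ∏' n : ℕ, (1 - nome τ ^ (r + N * n))).prod

/-- The theta quotients of level `p`, for `p = 5, 7, 11, 13, 17, 19`. -/
def thetaQuotient (p : ℕ) : Fin ((p - 1) / 2) → ℍ → ℂ :=
  match p with
  | 5 => ![
      fun τ => nome τ * qProd [1, 1] 1 τ / qProd [2, 3] 5 τ ^ 5,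
      fun τ => qProd [1, 1] 1 τ / qProd [1, 4] 5 τ ^ 5]
  | 7 => ![
      fun τ => nome τ * qProd [2, 5, 7, 7] 7 τ / qProd [3, 4] 7 τ ^ 2,
      fun τ => -nome τ * qProd [1, 6, 7, 7] 7 τ / qProd [2, 5] 7 τ ^ 2,
      fun τ => qProd [3, 4, 7, 7] 7 τ / qProd [1, 6] 7 τ ^ 2]
  | 11 => ![
      fun τ => qProd [4, 7, 11, 11] 11 τ / qProd [1, 10, 2, 9] 11 τ,
      fun τ => nome τ * qProd [5, 6, 11, 11] 11 τ / qProd [3, 8, 4, 7] 11 τ,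
      fun τ => nome τ ^ 2 * qProd [1, 10, 11, 11] 11 τ / qProd [3, 8, 5, 6] 11 τ,
      fun τ => nome τ * qProd [3, 8, 11, 11] 11 τ / qProd [2, 9, 4, 7] 11 τ,
      fun τ => nome τ * qProd [2, 9, 11, 11] 11 τ / qProd [5, 6, 1, 10] 11 τ]
  | 13 => ![
      fun τ => qProd [6, 7, 13, 13] 13 τ / qProd [1, 12, 3, 10] 13 τ,
      fun τ => nome τ * qProd [5, 8, 13, 13] 13 τ / qProd [3, 10, 4, 9] 13 τ,
      fun τ => nome τ * qProd [2, 11, 13, 13] 13 τ / qProd [1, 12, 4, 9] 13 τ,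
      fun τ => nome τ * qProd [4, 9, 13, 13] 13 τ / qProd [2, 11, 5, 8] 13 τ,
      fun τ => nome τ ^ 2 * qProd [3, 10, 13, 13] 13 τ / qProd [5, 8, 6, 7] 13 τ,
      fun τ => nome τ ^ 2 * qProd [1, 12, 13, 13] 13 τ / qProd [2, 11, 6, 7] 13 τ]
  | 17 => ![
      fun τ => qProd [8, 9, 17, 17] 17 τ / qProd [2, 15, 3, 14] 17 τ,
      fun τ => nome τ * qProd [5, 12, 17, 17] 17 τ / qProd [3, 14, 4, 13] 17 τ,
      fun τ => nome τ ^ 3 * qProd [1, 16, 17, 17] 17 τ / qProd [4, 13, 6, 11] 17 τ,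
      fun τ => nome τ ^ 2 * qProd [7, 10, 17, 17] 17 τ / qProd [6, 11, 8, 9] 17 τ,
      fun τ => nome τ ^ 3 * qProd [2, 15, 17, 17] 17 τ / qProd [5, 12, 8, 9] 17 τ,
      fun τ => nome τ * qProd [3, 14, 17, 17] 17 τ / qProd [1, 16, 5, 12] 17 τ,
      fun τ => nome τ * qProd [4, 13, 17, 17] 17 τ / qProd [1, 16, 7, 10] 17 τ,
      fun τ => nome τ * qProd [6, 11, 17, 17] 17 τ / qProd [2, 15, 7, 10] 17 τ]
  | 19 => ![
      fun τ => qProd [8, 11, 9, 10, 19, 19] 19 τ / qProd [3, 16, 4, 15, 5, 14] 19 τ,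
      fun τ => nome τ * qProd [2, 17, 7, 12, 19, 19] 19 τ / qProd [1, 18, 4, 15, 6, 13] 19 τ,
      fun τ => nome τ * qProd [3, 16, 9, 10, 19, 19] 19 τ / qProd [1, 18, 5, 14, 8, 11] 19 τ,
      fun τ => nome τ * qProd [4, 15, 7, 12, 19, 19] 19 τ / qProd [2, 17, 5, 14, 6, 13] 19 τ,
      fun τ => nome τ ^ 5 * qProd [1, 18, 3, 16, 19, 19] 19 τ / qProd [6, 13, 8, 11, 9, 10] 19 τ,
      fun τ => nome τ ^ 2 * qProd [4, 15, 5, 14, 19, 19] 19 τ / qProd [2, 17, 7, 12, 8, 11] 19 τ,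
      fun τ => nome τ ^ 2 * qProd [1, 18, 6, 13, 19, 19] 19 τ / qProd [2, 17, 3, 16, 9, 10] 19 τ,
      fun τ => nome τ ^ 2 * qProd [5, 14, 8, 11, 19, 19] 19 τ / qProd [4, 15, 7, 12, 9, 10] 19 τ,
      fun τ => nome τ * qProd [2, 17, 6, 13, 19, 19] 19 τ / qProd [1, 18, 3, 16, 7, 12] 19 τ]
  | _ => fun _ _ => 0

/-- The diamond operator in weight one:
`⟨γ⟩ f (τ) = (γ₂₁ τ + γ₂₂)⁻¹ f (γ τ)`, which is Mathlib's weight-one slash action. -/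
def diamond {p : ℕ} (γ : CongruenceSubgroup.Gamma0 p) (f : ℍ → ℂ) : ℍ → ℂ :=
  f ∣[(1 : ℤ)] (γ : SL(2, ℤ))

theorem diamond_apply {p : ℕ} (γ : CongruenceSubgroup.Gamma0 p) (f : ℍ → ℂ) (τ : ℍ) :
    diamond γ f τ = ((((γ : SL(2, ℤ)) 1 0 : ℤ) : ℂ) * τ + (((γ : SL(2, ℤ)) 1 1 : ℤ) : ℂ)) ^ (-1 : ℤ)
      * f ((γ : SL(2, ℤ)) • τ) := by
  rw [diamond, ModularForm.SL_slash_apply, mul_comm, ModularGroup.denom_apply]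

/-- The lower right entry modulo `p` of an element of `Γ₀(p)`, as a unit. -/
def lowerRight (p : ℕ) : CongruenceSubgroup.Gamma0 p →* (ZMod p)ˣ :=
  (CongruenceSubgroup.Gamma0Map p).toHomUnits

theorem lowerRight_coe (p : ℕ) (γ : CongruenceSubgroup.Gamma0 p) :
    (lowerRight p γ : ZMod p) = (((γ : SL(2, ℤ)) 1 1 : ℤ) : ZMod p) := rfl

/-- The group `(ℤ/pℤ)ˣ / {±1}`. -/
abbrev UnitsModSign (p : ℕ) : Type := (ZMod p)ˣ ⧸ Subgroup.zpowers (-1 : (ZMod p)ˣ)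

/-- The class of the lower right entry in `(ℤ/pℤ)ˣ / {±1}`. -/
def lowerRightClass (p : ℕ) : CongruenceSubgroup.Gamma0 p →* UnitsModSign p :=
  (QuotientGroup.mk' (Subgroup.zpowers (-1 : (ZMod p)ˣ))).comp (lowerRight p)

/-- The functions `f i` are permuted up to sign by the diamond operators of `Γ₀(p)`: there is a
permutation representation `ρ` of `Γ₀(p)` on the index set such that `⟨γ⟩ (f i)` is `f j` or
`- f j` precisely for `j = ρ γ i`. This representation is `(ℤ/pℤ)ˣ / {±1}`: its image is isomorphic
to this group through `ρ γ ↦ [γ₂₂]`, and the bijection `c` identifies the index set with the group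
in such a way that `ρ γ` becomes multiplication by `[γ₂₂]`. -/
def PermutedUpToSign (p : ℕ) {ι : Type} (f : ι → ℍ → ℂ) (c : ι → UnitsModSign p) : Prop :=
  ∃ ρ : CongruenceSubgroup.Gamma0 p →* Equiv.Perm ι,
    (∀ γ i j, (diamond γ (f i) = f j ∨ diamond γ (f i) = -f j) ↔ ρ γ i = j) ∧
    (∃ Φ : ρ.range ≃* UnitsModSign p, ∀ γ, Φ (ρ.rangeRestrict γ) = lowerRightClass p γ) ∧
    Function.Bijective c ∧
    ∀ γ i, c (ρ γ i) = lowerRightClass p γ * c i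

end

/-!
Everything rests on the Klein forms. For `τ` in the upper half plane the prime form `primeForm z τ`
is the odd entire function of `z` with simple zeros at the lattice points, derivative `2πi` at `0`,
and the usual quasi-periodicity. Its behaviour under `τ ↦ -1 / τ` follows from Liouville's theorem:
the quotient of the two sides is entire and doubly periodic, hence constant (`primeForm_neg_inv`).
Multiplying by an exponential and specialising `z` to a division point yields the Klein form
`kleinForm v τ` of weight `-1`, on which `SL(2, ℤ)` acts through its action on the row vector `v`
(`kleinForm_slash`). At level `p` only the characteristics `(g / p, 0)` and the point `p τ` are
needed: up to a root of unity, `γ ∈ Γ₀(p)` maps `levelKlein p g` to `levelKlein p (γ₁₁ g)`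
(`levelKlein_smul`), and `levelKlein p g` depends only on `± g` modulo `p`, up to sign.

*Eisenstein series.* The logarithmic derivative of the prime form in `z` gives the Hecke forms
`levelHecke p g`, of weight one, on which `γ` acts exactly as `g ↦ γ₁₁ g`. Expanding them as Lambert
series and using `ζ(0, x) = 1 / 2 - x` to evaluate `L(0, χ)`, the sum of `χ(g) levelHecke p g`
over `g` is a nonzero multiple of `E_{1,χ}` (`sum_levelHecke`), so `⟨γ⟩ E_{1,χ} = χ(γ₂₂) E_{1,χ}`.
Hence `⟨γ⟩ 𝓔_p` is the combination `eisensteinTwist p γ₂₂` (`diamond_eisensteinSum`). By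
orthogonality of the odd characters, the constant term of `eisensteinTwist p d` is `± 1` for
`d = ± 1` and `0` otherwise.

*Theta quotients.* By the product expansion `levelKlein_mul_qProd`, the theta quotients of level `p`
are, up to sign, the quotients `kleinQuotient p M N u` of Klein forms with characteristics `u m / p`,
where `M` and `N` are fixed and `u` runs through representatives of `(ℤ/pℤ)ˣ / {±1}`. As the sums of
squares of `M` and `N` agree modulo `p`, the roots of unity in `levelKlein_smul` combine to a sign,
and `⟨γ⟩` multiplies `u` by `γ₁₁` (`diamond_kleinQuotient`). Exactly one member of the family has a
nonzero constant term.

In both cases the diamond operators act transitively up to sign on a family of which exactly one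
member has a nonzero limit at `i∞`. Therefore the members are distinct up to sign, which gives the
permutation representation (`permutedUpToSign_of_tendsto`).
-/

/-! ### The value of the Hurwitz zeta function at zero -/

theorem hasDerivAt_ofReal_cpow_of_pos (r : ℂ) {v : ℝ} (hv : 0 < v) :
    HasDerivAt (fun y : ℝ ↦ (y : ℂ) ^ r) (r * (v : ℂ) ^ (r - 1)) v :=
  ((Complex.hasStrictDerivAt_cpow_const (Or.inl (by simpa using hv))).hasDerivAt).comp_ofReal

/-- The second order Taylor remainder of `u ↦ u ^ (-s)`, as the general term of a series that
converges beyond the line `Re s = 0`. -/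
noncomputable def hurwitzRemainder (x : ℝ) (n : ℕ) (s : ℂ) : ℂ :=
  (((n + x : ℝ) : ℂ)) ^ (-s) - (((n + 1 : ℝ) : ℂ)) ^ (-s)
    - (1 - x) * s * (((n + 1 : ℝ) : ℂ)) ^ (-s - 1)

theorem norm_hurwitzRemainder_le {x : ℝ} (hx : 0 < x) (hx1 : x ≤ 1) (n : ℕ) {s : ℂ}
    (hs : -(1 / 2) < s.re) (hs3 : ‖s‖ < 3) :
    ‖hurwitzRemainder x n s‖ ≤ 12 * x ^ (-5 : ℝ) * ((n : ℝ) + 1) ^ (-(3 / 2) : ℝ) := by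
  set M : ℝ := x ^ (-5 : ℝ) * ((n : ℝ) + 1) ^ (-(3 / 2) : ℝ) with hM
  have hM0 : 0 ≤ M := by positivity
  have hre : s.re ≤ 3 := (Complex.re_le_norm s).trans hs3.le
  set I : Set ℝ := Set.Icc (n + x : ℝ) (n + 1) with hI
  have hpos : ∀ v ∈ I, 0 < v := fun v hv ↦ by
    have : (0 : ℝ) ≤ n := n.cast_nonneg
    linarith [hv.1]
  have h1I : (n + 1 : ℝ) ∈ I := ⟨by linarith, le_rfl⟩
  have hxI : (n + x : ℝ) ∈ I := ⟨le_rfl, by linarith⟩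
  have hdist : ∀ v ∈ I, ‖v - (n + 1 : ℝ)‖ ≤ 1 := fun v hv ↦ by
    rw [Real.norm_eq_abs, abs_le]; constructor <;> linarith [hv.1, hv.2]
  -- bound of the second derivative
  have hb : ∀ v ∈ I, ‖(v : ℂ) ^ (-s - 1 - 1)‖ ≤ M := by
    intro v hv
    rw [Complex.norm_cpow_eq_rpow_re_of_pos (hpos v hv)]
    have e : (-s - 1 - 1).re = -(s.re + 2) := by simp; ring
    rw [e]
    have hn : (0 : ℝ) ≤ n := n.cast_nonneg
    have hv' : x * (n + 1) ≤ v := by nlinarith [hv.1]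
    have h1 : v ^ (-(s.re + 2)) ≤ (x * (n + 1)) ^ (-(s.re + 2)) :=
      Real.rpow_le_rpow_of_nonpos (by positivity) hv' (by linarith)
    refine h1.trans ?_
    rw [Real.mul_rpow hx.le (by positivity), hM]
    exact mul_le_mul (Real.rpow_le_rpow_of_exponent_ge hx hx1 (by linarith))
      (Real.rpow_le_rpow_of_exponent_le (by linarith) (by linarith)) (by positivity) (by positivity)
  have h2 : ∀ v ∈ I, ‖(v : ℂ) ^ (-s - 1) - ((n + 1 : ℝ) : ℂ) ^ (-s - 1)‖ ≤ 4 * M := by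
    intro v hv
    have := (convex_Icc (n + x : ℝ) (n + 1)).norm_image_sub_le_of_norm_hasDerivWithin_le
      (f := fun v : ℝ ↦ (v : ℂ) ^ (-s - 1)) (C := 4 * M)
      (fun u hu ↦ (hasDerivAt_ofReal_cpow_of_pos (-s - 1) (hpos u hu)).hasDerivWithinAt)
      (fun u hu ↦ ?_) h1I hv
    · refine this.trans ?_
      have := hdist v hv
      nlinarith
    · rw [norm_mul]
      have h3 : ‖-s - 1‖ ≤ 4 := by
        calc ‖-s - 1‖ ≤ ‖-s‖ + ‖(1 : ℂ)‖ := norm_sub_le _ _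
          _ ≤ 4 := by rw [norm_neg, norm_one]; linarith
      exact mul_le_mul h3 (hb u hu) (norm_nonneg _) (by norm_num)
  set c : ℂ := ((n + 1 : ℝ) : ℂ) ^ (-s - 1) with hc
  have h4 := (convex_Icc (n + x : ℝ) (n + 1)).norm_image_sub_le_of_norm_hasDerivWithin_le
      (f := fun v : ℝ ↦ (v : ℂ) ^ (-s) + s * c * v) (C := 12 * M)
      (f' := fun v : ℝ ↦ -s * (v : ℂ) ^ (-s - 1) + s * c * 1)
      (fun u hu ↦ ((hasDerivAt_ofReal_cpow_of_pos (-s) (hpos u hu)).add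
        ((Complex.ofRealCLM.hasDerivAt (x := u)).const_mul (s * c))).hasDerivWithinAt)
      (fun u hu ↦ ?_) h1I hxI
  · have e : hurwitzRemainder x n s
        = ((((n + x : ℝ) : ℂ)) ^ (-s) + s * c * ((n + x : ℝ) : ℂ))
          - ((((n + 1 : ℝ) : ℂ)) ^ (-s) + s * c * ((n + 1 : ℝ) : ℂ)) := by
      rw [hurwitzRemainder, ← hc]; push_cast; ring
    rw [e]
    refine h4.trans ?_
    have := hdist _ hxI
    nlinarith
  · have e : -s * (u : ℂ) ^ (-s - 1) + s * c * 1 = -(s * ((u : ℂ) ^ (-s - 1) - c)) := by ring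
    rw [e, norm_neg, norm_mul]
    have := h2 u hu
    have h5 := norm_nonneg ((u : ℂ) ^ (-s - 1) - c)
    nlinarith [norm_nonneg s]

theorem summable_hurwitzRemainder_bound (x : ℝ) :
    Summable fun n : ℕ ↦ 12 * x ^ (-5 : ℝ) * ((n : ℝ) + 1) ^ (-(3 / 2) : ℝ) := by
  refine Summable.mul_left _ ?_
  have := (summable_nat_add_iff 1).mpr
    (Real.summable_nat_rpow (p := -(3 / 2)) |>.mpr (by norm_num))
  simpa using this

theorem differentiable_hurwitzRemainder {x : ℝ} (hx : 0 < x) (n : ℕ) :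
    Differentiable ℂ (hurwitzRemainder x n) := by
  have h1 : ((n + x : ℝ) : ℂ) ≠ 0 := by
    have : (0 : ℝ) < n + x := by positivity
    exact_mod_cast this.ne'
  have h2 : ((n + 1 : ℝ) : ℂ) ≠ 0 := by
    have : (0 : ℝ) < n + 1 := by positivity
    exact_mod_cast this.ne'
  unfold hurwitzRemainder
  intro s
  have d1 := (differentiableAt_id (𝕜 := ℂ) (x := s)).neg.const_cpow (Or.inl h1)
  have d2 := (differentiableAt_id (𝕜 := ℂ) (x := s)).neg.const_cpow (Or.inl h2)
  have d3 := ((differentiableAt_id (𝕜 := ℂ) (x := s)).neg.sub_const 1).const_cpow (Or.inl h2)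
  exact (d1.sub d2).sub (((differentiableAt_id).const_mul _).mul d3)

open Filter Topology HurwitzZeta in
/-- For `0 < x ≤ 1`, `ζ(0, x) = 1/2 - x`. For `Re s > 1` one has
`∑ₙ hurwitzRemainder x n s = ζ(s, x) - ζ(s, 1) - (1 - x) s ζ(s + 1, 1)`; both sides are
analytic for `Re s > 0`, the left side up to `Re s > -1/2`, and it vanishes at `s = 0`. -/
theorem hurwitzZeta_apply_zero {x : ℝ} (hx : 0 < x) (hx1 : x ≤ 1) :
    hurwitzZeta (x : UnitAddCircle) 0 = 1 / 2 - x := by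
  set U : Set ℂ := {s | -(1 / 2) < s.re} ∩ Metric.ball 0 3 with hU
  have hUo : IsOpen U :=
    (isOpen_lt continuous_const Complex.continuous_re).inter Metric.isOpen_ball
  set H : ℂ → ℂ := fun s ↦ ∑' n, hurwitzRemainder x n s with hH
  have hHd : DifferentiableOn ℂ H U :=
    Complex.differentiableOn_tsum_of_summable_norm (summable_hurwitzRemainder_bound x)
      (fun n ↦ (differentiable_hurwitzRemainder hx n).differentiableOn) hUo
      (fun n s hs ↦ norm_hurwitzRemainder_le hx hx1 n hs.1 (by simpa using hs.2))
  set V : Set ℂ := {s | 0 < s.re} ∩ Metric.ball 0 3 with hV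
  have hVo : IsOpen V :=
    (isOpen_lt continuous_const Complex.continuous_re).inter Metric.isOpen_ball
  have hVU : V ⊆ U := fun s hs ↦ ⟨by have := hs.1; simp at this ⊢; linarith, hs.2⟩
  have hVc : Convex ℝ V :=
    (convex_halfSpace_re_gt 0).inter (convex_ball _ _)
  set G : ℂ → ℂ := fun s ↦ (hurwitzZeta (x : UnitAddCircle) s
    - hurwitzZeta ((1 : ℝ) : UnitAddCircle) s)
    - (1 - x) * (s * hurwitzZeta ((1 : ℝ) : UnitAddCircle) (s + 1)) with hG
  have hd := differentiable_hurwitzZeta_sub_hurwitzZeta (x : UnitAddCircle) ((1 : ℝ) : UnitAddCircle)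
  have hGd : DifferentiableOn ℂ G V := by
    intro s hs
    have hs0 : s + 1 ≠ 1 := by
      intro h
      have : s = 0 := by linear_combination h
      simp [hV, this] at hs
    have h1 : DifferentiableAt ℂ (fun s ↦ hurwitzZeta ((1 : ℝ) : UnitAddCircle) (s + 1)) s :=
      (differentiableAt_hurwitzZeta _ hs0).comp s (differentiableAt_id.add_const 1)
    exact ((hd s).sub ((differentiableAt_id.mul h1).const_mul _)).differentiableWithinAt
  have heq : Set.EqOn G H V := by
    refine (hGd.analyticOnNhd hVo).eqOn_of_preconnected_of_eventuallyEq
      ((hHd.mono hVU).analyticOnNhd hVo) hVc.isPreconnected (z₀ := 2) ⟨by simp, by simp; norm_num⟩ ?_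
    have : {s : ℂ | 1 < s.re} ∈ 𝓝 (2 : ℂ) :=
      (isOpen_lt continuous_const Complex.continuous_re).mem_nhds (by simp)
    filter_upwards [this] with s hs
    have hs' : 1 < s.re := hs
    have s1 := hasSum_hurwitzZeta_of_one_lt_re (a := x) ⟨hx.le, hx1⟩ hs'
    have s2 := hasSum_hurwitzZeta_of_one_lt_re (a := 1) ⟨zero_le_one, le_rfl⟩ hs'
    have s3 := hasSum_hurwitzZeta_of_one_lt_re (a := 1) ⟨zero_le_one, le_rfl⟩
      (s := s + 1) (by simp; linarith)
    refine (((s1.sub s2).sub ((s3.mul_left s).mul_left (1 - (x : ℂ)))).congr_fun ?_).tsum_eq.symm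
    intro n
    rw [hurwitzRemainder, one_div, one_div, one_div, ← Complex.cpow_neg, ← Complex.cpow_neg,
      ← Complex.cpow_neg, neg_add, ← sub_eq_add_neg]
    push_cast
    ring
  -- let `s → 0` inside the half plane `Re s > 0`
  have hcl : (𝓝[V] (0 : ℂ)).NeBot := by
    refine mem_closure_iff_nhdsWithin_neBot.mp ?_
    have ht : Tendsto (fun n : ℕ ↦ (((1 / ((n : ℝ) + 1) : ℝ)) : ℂ)) atTop (𝓝 0) := by
      have := (Complex.continuous_ofReal.tendsto 0).comp tendsto_one_div_add_atTop_nhds_zero_nat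
      rwa [Complex.ofReal_zero] at this
    refine mem_closure_of_tendsto ht (Eventually.of_forall fun n ↦ ⟨?_, ?_⟩)
    · simp only [Set.mem_ofPred_eq, Complex.ofReal_re]; positivity
    · rw [mem_ball_zero_iff, Complex.norm_real, Real.norm_eq_abs, abs_of_pos (by positivity)]
      have : 1 / ((n : ℝ) + 1) ≤ 1 := by
        rw [div_le_one (by positivity)]; linarith [n.cast_nonneg (α := ℝ)]
      linarith
  have l1 : Tendsto H (𝓝[V] 0) (𝓝 0) := by
    have h0 : H 0 = 0 := by
      simp [hH, hurwitzRemainder]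
    have : ContinuousAt H 0 :=
      (hHd.differentiableAt (hUo.mem_nhds ⟨by norm_num, by simp⟩)).continuousAt
    have := this.tendsto.mono_left (nhdsWithin_le_nhds (s := V))
    rwa [h0] at this
  have l2 : Tendsto G (𝓝[V] 0) (𝓝 ((hurwitzZeta (x : UnitAddCircle) 0
      - hurwitzZeta ((1 : ℝ) : UnitAddCircle) 0) - (1 - x) * 1)) := by
    refine ((hd.continuous.tendsto 0).mono_left nhdsWithin_le_nhds).sub (Tendsto.const_mul _ ?_)
    have h1 : Tendsto (fun s : ℂ ↦ s + 1) (𝓝[V] 0) (𝓝[≠] 1) := by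
      refine tendsto_nhdsWithin_iff.mpr ⟨?_, ?_⟩
      · have : Tendsto (fun s : ℂ ↦ s + 1) (𝓝 0) (𝓝 (0 + 1)) := (continuous_add_const 1).tendsto 0
        rw [zero_add] at this
        exact this.mono_left nhdsWithin_le_nhds
      · filter_upwards [self_mem_nhdsWithin] with s hs h
        have : s = 0 := by simpa using h
        simp [hV, this] at hs
    exact ((hurwitzZeta_residue_one ((1 : ℝ) : UnitAddCircle)).comp h1).congr
      fun s ↦ by simp only [Function.comp_apply, add_sub_cancel_right]
  have l3 := tendsto_nhds_unique (l2.congr' (by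
    filter_upwards [self_mem_nhdsWithin] with s hs using heq hs)) l1
  have h1 : hurwitzZeta ((1 : ℝ) : UnitAddCircle) 0 = -1 / 2 := by
    have : ((1 : ℝ) : UnitAddCircle) = 0 := AddCircle.coe_period 1
    rw [this, hurwitzZeta_zero, riemannZeta_zero]
  rw [h1] at l3
  linear_combination l3

open HurwitzZeta in
/-- For any character modulo `N > 1`, `L(0, χ) = - ∑ χ(g) (g / N - 1 / 2)`. -/
theorem LFunction_apply_zero {N : ℕ} [NeZero N] (hN : 1 < N) (χ : DirichletCharacter ℂ N) :
    DirichletCharacter.LFunction χ 0 = -∑ g : ZMod N, χ g * ((g.val : ℂ) / N - 1 / 2) := by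
  have : Fact (1 < N) := ⟨hN⟩
  rw [DirichletCharacter.LFunction, ZMod.LFunction, neg_zero, Complex.cpow_zero, one_mul,
    ← Finset.sum_neg_distrib]
  refine Finset.sum_congr rfl fun g _ ↦ ?_
  rcases eq_or_ne g 0 with rfl | hg
  · simp [MulChar.map_zero]
  · have h0 : 0 < g.val := Nat.pos_of_ne_zero ((ZMod.val_ne_zero g).mpr hg)
    have hN0 : (0 : ℝ) < N := by exact_mod_cast NeZero.pos N
    rw [ZMod.toAddCircle_apply, hurwitzZeta_apply_zero (by positivity)
      ((div_le_one hN0).mpr (by exact_mod_cast (ZMod.val_lt g).le))]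
    push_cast
    ring

theorem DirichletCharacter.Odd.ne_one {N : ℕ} {χ : DirichletCharacter ℂ N} (hodd : χ.Odd) :
    χ ≠ 1 := by
  rintro rfl
  rw [DirichletCharacter.Odd, MulChar.one_apply isUnit_one.neg] at hodd
  norm_num at hodd

theorem isPrimitive_of_ne_one {p : ℕ} [Fact p.Prime] {χ : DirichletCharacter ℂ p} (hχ : χ ≠ 1) :
    χ.IsPrimitive :=
  ((Nat.dvd_prime Fact.out).mp χ.conductor_dvd_level).resolve_left fun h ↦
    hχ (DirichletCharacter.eq_one_iff_conductor_eq_one.mpr h)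

/-- `L(0, χ) ≠ 0` for odd `χ`: the functional equation relates it to `L(1, χ⁻¹)`. -/
theorem LFunction_apply_zero_ne_zero {p : ℕ} [Fact p.Prime] {χ : DirichletCharacter ℂ p}
    (hodd : χ.Odd) : DirichletCharacter.LFunction χ 0 ≠ 0 := by
  have hp : p ≠ 1 := (Fact.out : p.Prime).ne_one
  have hne : χ⁻¹ ≠ 1 := inv_ne_one.mpr hodd.ne_one
  intro h0
  have h1 := DirichletCharacter.LFunction_eq_completed_div_gammaFactor χ 0 (Or.inr hp)
  rw [h0, hodd.gammaFactor_def, zero_add, Complex.Gammaℝ_one, div_one] at h1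
  have h2 := (isPrimitive_of_ne_one hne).completedLFunction_one_sub 0
  rw [inv_inv, ← h1, mul_zero, sub_zero] at h2
  have h3 := DirichletCharacter.LFunction_eq_completed_div_gammaFactor χ⁻¹ 1 (Or.inr hp)
  rw [h2, zero_div] at h3
  exact DirichletCharacter.LFunction_apply_one_ne_zero hne h3

/-! ### The infinite product `∏ (1 - a qⁿ)` -/

/-- The `q`-Pochhammer symbol `(a; q)_∞ = ∏_{n ≥ 0} (1 - a qⁿ)`. -/
noncomputable def qPoch (a q : ℂ) : ℂ := ∏' n : ℕ, (1 - a * q ^ n)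

theorem summable_norm_qPoch (a : ℂ) {q : ℂ} (hq : ‖q‖ < 1) :
    Summable fun n : ℕ ↦ ‖-(a * q ^ n)‖ := by
  simpa [norm_mul, norm_pow] using (summable_geometric_of_lt_one (norm_nonneg q) hq).mul_left ‖a‖

theorem multipliable_qPoch (a : ℂ) {q : ℂ} (hq : ‖q‖ < 1) :
    Multipliable fun n : ℕ ↦ (1 - a * q ^ n) := by
  simpa [sub_eq_add_neg] using multipliable_one_add_of_summable (summable_norm_qPoch a hq)

theorem qPoch_eq_mul (a : ℂ) {q : ℂ} (hq : ‖q‖ < 1) :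
    qPoch a q = (1 - a) * qPoch (a * q) q := by
  have h : Multipliable fun n : ℕ ↦ (1 - a * q ^ (n + 1)) := by
    simpa [pow_succ', mul_assoc] using multipliable_qPoch (a * q) hq
  have h1 : qPoch a q = (1 - a * q ^ 0) * ∏' n : ℕ, (1 - a * q ^ (n + 1)) :=
    tprod_eq_zero_mul' (f := fun n : ℕ ↦ 1 - a * q ^ n) h
  rw [h1, pow_zero, mul_one, qPoch]
  simp only [pow_succ', mul_assoc]

theorem qPoch_ne_zero {a q : ℂ} (hq : ‖q‖ < 1) (h : ∀ n : ℕ, a * q ^ n ≠ 1) : qPoch a q ≠ 0 := by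
  have := tprod_one_add_ne_zero_of_summable (f := fun n : ℕ ↦ -(a * q ^ n))
    (fun n ↦ by rw [← sub_eq_add_neg]; exact sub_ne_zero.mpr (h n).symm) (summable_norm_qPoch a hq)
  simpa [qPoch, sub_eq_add_neg] using this

theorem qPoch_ne_zero_of_norm_lt {a q : ℂ} (hq : ‖q‖ < 1) (ha : ‖a‖ < 1) : qPoch a q ≠ 0 := by
  refine qPoch_ne_zero hq fun n h ↦ ?_
  have h1 : ‖a * q ^ n‖ < 1 := by
    rw [norm_mul, norm_pow]
    exact mul_lt_one_of_nonneg_of_lt_one_left (norm_nonneg _) ha (pow_le_one₀ (norm_nonneg _) hq.le)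
  rw [h, norm_one] at h1
  exact lt_irrefl _ h1

theorem multipliableLocallyUniformlyOn_qPoch {q : ℂ} (hq : ‖q‖ < 1) :
    MultipliableLocallyUniformlyOn (fun (n : ℕ) a ↦ 1 - a * q ^ n) Set.univ := by
  refine HasProdLocallyUniformlyOn.multipliableLocallyUniformlyOn (g := fun a ↦ qPoch a q)
    (hasProdLocallyUniformlyOn_of_forall_compact isOpen_univ fun K _ hK ↦ ?_)
  obtain ⟨C, hC⟩ := hK.exists_bound_of_continuousOn (f := fun a : ℂ ↦ a) continuousOn_id
  have := Summable.hasProdUniformlyOn_nat_one_add (f := fun (n : ℕ) (a : ℂ) ↦ -(a * q ^ n)) (K := K)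
    hK (u := fun n ↦ C * ‖q‖ ^ n) ((summable_geometric_of_lt_one (norm_nonneg q) hq).mul_left C)
    (Filter.Eventually.of_forall fun n a ha ↦ ?_) (fun n ↦ by fun_prop)
  · simpa [qPoch, sub_eq_add_neg] using this
  · rw [norm_neg, norm_mul, norm_pow]
    exact mul_le_mul_of_nonneg_right (hC a ha) (by positivity)

theorem differentiable_qPoch {q : ℂ} (hq : ‖q‖ < 1) : Differentiable ℂ fun a ↦ qPoch a q := by
  have := (multipliableLocallyUniformlyOn_qPoch hq).hasProdLocallyUniformlyOn.differentiableOn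
    (Filter.Eventually.of_forall fun s ↦ by fun_prop) isOpen_univ
  exact differentiableOn_univ.mp this

theorem summable_div_one_sub {f b : ℕ → ℂ} (hf : Summable fun n ↦ ‖f n‖)
    (hb : Filter.Tendsto b Filter.atTop (nhds 0)) : Summable fun n ↦ f n / (1 - b n) := by
  have h1 : Filter.Tendsto (fun n ↦ (1 - b n)⁻¹) Filter.atTop (nhds ((1 - 0)⁻¹)) :=
    (hb.const_sub 1).inv₀ (by simp)
  have h2 := (Asymptotics.isBigO_refl f Filter.atTop).mul (h1.isBigO_one ℂ)
  refine summable_of_isBigO_nat hf (h2.trans ?_)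
  simpa using (Asymptotics.isBigO_refl f Filter.atTop).norm_right

theorem logDeriv_qPoch {a q : ℂ} (hq : ‖q‖ < 1) (h : ∀ n : ℕ, a * q ^ n ≠ 1) :
    logDeriv (fun a ↦ qPoch a q) a = ∑' n : ℕ, -q ^ n / (1 - a * q ^ n) := by
  have hne : ∀ n : ℕ, 1 - a * q ^ n ≠ 0 := fun n ↦ sub_ne_zero.mpr (h n).symm
  have hterm : ∀ n : ℕ, logDeriv (fun a ↦ 1 - a * q ^ n) a = -q ^ n / (1 - a * q ^ n) := by
    intro n
    rw [logDeriv_apply]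
    congr 1
    simp [(((hasDerivAt_id' a).mul_const (q ^ n)).const_sub 1).deriv]
  have hsum : Summable fun n : ℕ ↦ -q ^ n / (1 - a * q ^ n) := by
    refine summable_div_one_sub ?_ ?_
    · simpa using summable_geometric_of_lt_one (norm_nonneg q) hq
    · simpa using (tendsto_pow_atTop_nhds_zero_of_norm_lt_one hq).const_mul a
  rw [← tsum_congr hterm]
  exact logDeriv_tprod_eq_tsum isOpen_univ (Set.mem_univ a) (f := fun (n : ℕ) a ↦ 1 - a * q ^ n) hne
    (fun n ↦ by fun_prop) (hsum.congr fun n ↦ (hterm n).symm)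
    (multipliableLocallyUniformlyOn_qPoch hq) (qPoch_ne_zero hq h)

theorem norm_qPoch_sub_one_le (a : ℂ) {q : ℂ} (hq : ‖q‖ < 1) :
    ‖qPoch a q - 1‖ ≤ Real.exp (‖a‖ / (1 - ‖q‖)) - 1 := by
  have hs := summable_norm_qPoch a hq
  have ht : ∑' n : ℕ, ‖-(a * q ^ n)‖ = ‖a‖ / (1 - ‖q‖) := by
    simp [norm_pow, tsum_mul_left, tsum_geometric_of_lt_one (norm_nonneg q) hq,
      div_eq_mul_inv]
  refine le_of_tendsto ((multipliable_qPoch a hq).hasProd.sub_const (1 : ℂ)).norm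
    (Filter.Eventually.of_forall fun s ↦ ?_)
  have := s.norm_prod_one_add_sub_one_le (fun n : ℕ ↦ -(a * q ^ n))
  simp only [← sub_eq_add_neg] at this
  refine this.trans ?_
  gcongr
  rw [← ht]
  exact hs.sum_le_tsum s (fun _ _ ↦ norm_nonneg _)

/-! ### The prime form and its zeros -/

open Complex in
/-- The normalised odd theta function
`(w^{1/2} - w^{-1/2}) ∏_{n ≥ 1} (1 - qⁿ w) (1 - qⁿ w⁻¹) / (1 - qⁿ)²`, with `w = exp (2 π i z)` and
`q = exp (2 π i τ)`; it is `exp (- η z² / 2)` times the Weierstrass `σ`-function, up to a factor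
`2 π i`. -/
noncomputable def primeForm (z τ : ℂ) : ℂ :=
  (cexp (Real.pi * I * z) - cexp (-(Real.pi * I * z)))
    * (qPoch (cexp (2 * Real.pi * I * τ) * cexp (2 * Real.pi * I * z)) (cexp (2 * Real.pi * I * τ))
      * qPoch (cexp (2 * Real.pi * I * τ) * cexp (-(2 * Real.pi * I * z)))
        (cexp (2 * Real.pi * I * τ)))
    / qPoch (cexp (2 * Real.pi * I * τ)) (cexp (2 * Real.pi * I * τ)) ^ 2

section
open Complex

theorem norm_cexp_two_pi_lt_one {τ : ℂ} (hτ : 0 < τ.im) : ‖cexp (2 * Real.pi * I * τ)‖ < 1 := by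
  rw [Complex.norm_exp, Real.exp_lt_one_iff]
  have : (2 * Real.pi * I * τ).re = -(2 * Real.pi * τ.im) := by simp
  rw [this]
  have := Real.pi_pos
  have : 0 < 2 * Real.pi * τ.im := by positivity
  linarith

theorem primeForm_neg (z τ : ℂ) : primeForm (-z) τ = -primeForm z τ := by
  simp only [primeForm, mul_neg, neg_neg]
  ring

theorem primeForm_add_one (z τ : ℂ) : primeForm (z + 1) τ = -primeForm z τ := by
  have h1 : cexp (Real.pi * I * (z + 1)) = -cexp (Real.pi * I * z) := by
    rw [mul_add, Complex.exp_add, mul_one, Complex.exp_pi_mul_I]; ring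
  have h2 : cexp (-(Real.pi * I * (z + 1))) = -cexp (-(Real.pi * I * z)) := by
    rw [Complex.exp_neg, h1, Complex.exp_neg, inv_neg]
  have h3 : cexp (2 * Real.pi * I * (z + 1)) = cexp (2 * Real.pi * I * z) := by
    rw [mul_add, Complex.exp_add, mul_one, Complex.exp_two_pi_mul_I, mul_one]
  have h4 : cexp (-(2 * Real.pi * I * (z + 1))) = cexp (-(2 * Real.pi * I * z)) := by
    rw [Complex.exp_neg, h3, Complex.exp_neg]
  rw [primeForm, primeForm, h1, h2, h3, h4]
  ring

theorem primeForm_add_period {τ : ℂ} (hτ : 0 < τ.im) (z : ℂ) :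
    primeForm (z + τ) τ = -cexp (-(Real.pi * I * τ) - 2 * Real.pi * I * z) * primeForm z τ := by
  have hq := norm_cexp_two_pi_lt_one hτ
  set u := cexp (Real.pi * I * z) with hu
  set h := cexp (Real.pi * I * τ) with hh
  have hu0 : u ≠ 0 := Complex.exp_ne_zero _
  have hh0 : h ≠ 0 := Complex.exp_ne_zero _
  have e1 : cexp (2 * Real.pi * I * τ) = h ^ 2 := by
    rw [hh, ← Complex.exp_nat_mul]; congr 1; push_cast; ring
  have e2 : cexp (2 * Real.pi * I * z) = u ^ 2 := by
    rw [hu, ← Complex.exp_nat_mul]; congr 1; push_cast; ring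
  have e3 : cexp (2 * Real.pi * I * (z + τ)) = u ^ 2 * h ^ 2 := by
    rw [mul_add, Complex.exp_add, e1, e2]
  have e4 : cexp (Real.pi * I * (z + τ)) = u * h := by rw [mul_add, Complex.exp_add]
  have e5 : cexp (-(Real.pi * I * τ) - 2 * Real.pi * I * z) = h⁻¹ * (u ^ 2)⁻¹ := by
    rw [Complex.exp_sub, Complex.exp_neg, e2, div_eq_mul_inv]
  simp only [primeForm, Complex.exp_neg, e1, e2, e3, e4, e5, ← hu]
  rw [e1] at hq
  rw [qPoch_eq_mul (h ^ 2 * u ^ 2) hq, show h ^ 2 * (u ^ 2 * h ^ 2)⁻¹ = (u ^ 2)⁻¹ by field_simp,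
    qPoch_eq_mul (u ^ 2)⁻¹ hq, show h ^ 2 * (u ^ 2 * h ^ 2) = h ^ 2 * u ^ 2 * h ^ 2 by ring,
    show (u ^ 2)⁻¹ * h ^ 2 = h ^ 2 * (u ^ 2)⁻¹ by ring]
  field_simp
  ring

theorem qPoch_self_ne_zero {q : ℂ} (hq : ‖q‖ < 1) : qPoch q q ≠ 0 :=
  qPoch_ne_zero_of_norm_lt hq hq

theorem differentiable_primeForm {τ : ℂ} (hτ : 0 < τ.im) :
    Differentiable ℂ fun z ↦ primeForm z τ := by
  have hq := norm_cexp_two_pi_lt_one hτ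
  have h1 : Differentiable ℂ fun z ↦ qPoch (cexp (2 * Real.pi * I * τ) * cexp (2 * Real.pi * I * z))
      (cexp (2 * Real.pi * I * τ)) := (differentiable_qPoch hq).comp (by fun_prop)
  have h2 : Differentiable ℂ fun z ↦ qPoch (cexp (2 * Real.pi * I * τ) *
      cexp (-(2 * Real.pi * I * z))) (cexp (2 * Real.pi * I * τ)) :=
    (differentiable_qPoch hq).comp (by fun_prop)
  unfold primeForm
  fun_prop

theorem primeForm_zero (τ : ℂ) : primeForm 0 τ = 0 := by simp [primeForm]

theorem hasDerivAt_primeForm_zero {τ : ℂ} (hτ : 0 < τ.im) :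
    HasDerivAt (fun z ↦ primeForm z τ) (2 * Real.pi * I) 0 := by
  have hq := norm_cexp_two_pi_lt_one hτ
  have hq0 := qPoch_self_ne_zero hq
  have h1 : Differentiable ℂ fun z ↦ qPoch (cexp (2 * Real.pi * I * τ) * cexp (2 * Real.pi * I * z))
      (cexp (2 * Real.pi * I * τ)) := (differentiable_qPoch hq).comp (by fun_prop)
  have h2 : Differentiable ℂ fun z ↦ qPoch (cexp (2 * Real.pi * I * τ) *
      cexp (-(2 * Real.pi * I * z))) (cexp (2 * Real.pi * I * τ)) :=
    (differentiable_qPoch hq).comp (by fun_prop)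
  have hl : HasDerivAt (fun z : ℂ ↦ Real.pi * I * z) (Real.pi * I) 0 := by
    simpa using (hasDerivAt_id (0 : ℂ)).const_mul (Real.pi * I : ℂ)
  have h3 := hl.cexp.sub hl.neg.cexp
  have h4 := (h3.mul ((h1 0).hasDerivAt.mul (h2 0).hasDerivAt)).div_const
    (qPoch (cexp (2 * Real.pi * I * τ)) (cexp (2 * Real.pi * I * τ)) ^ 2)
  refine (h4.congr_deriv ?_)
  simp only [Pi.mul_apply, Pi.sub_apply, Pi.neg_apply, mul_zero, neg_zero, Complex.exp_zero, mul_one, sub_self,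
    zero_mul, add_zero]
  generalize qPoch _ _ = Q at hq0 ⊢
  field_simp
  ring

theorem primeForm_eq_zero_iff {τ : ℂ} (hτ : 0 < τ.im) {z : ℂ} :
    primeForm z τ = 0 ↔ ∃ m n : ℤ, z = m + n * τ := by
  have hq := norm_cexp_two_pi_lt_one hτ
  constructor
  · intro h
    have key : ∀ (k : ℤ) (ε : ℤ), (ε = 1 ∨ ε = -1) →
        cexp (2 * Real.pi * I * (k * τ + ε * z)) = 1 → ∃ m n : ℤ, z = m + n * τ := by
      intro k ε hε h
      obtain ⟨m, hm⟩ := Complex.exp_eq_one_iff.mp h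
      have hm' : k * τ + ε * z = m := by
        have : (2 * Real.pi * I : ℂ) ≠ 0 := Complex.two_pi_I_ne_zero
        apply mul_left_cancel₀ this
        rw [hm]; ring
      rcases hε with rfl | rfl
      · refine ⟨m, -k, ?_⟩
        push_cast at hm' ⊢
        linear_combination hm'
      · refine ⟨-m, k, ?_⟩
        push_cast at hm' ⊢
        linear_combination -hm'
    by_contra hcon
    have hne : ∀ (k : ℤ) (ε : ℤ), (ε = 1 ∨ ε = -1) →
        cexp (2 * Real.pi * I * (k * τ + ε * z)) ≠ 1 := fun k ε hε h ↦ hcon (key k ε hε h)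
    rw [primeForm, div_eq_zero_iff, mul_eq_zero, mul_eq_zero] at h
    rcases h with (h | h | h) | h
    · refine hne 0 1 (Or.inl rfl) ?_
      rw [show 2 * Real.pi * I * (((0 : ℤ) : ℂ) * τ + ((1 : ℤ) : ℂ) * z)
        = Real.pi * I * z + Real.pi * I * z by push_cast; ring, Complex.exp_add]
      nth_rewrite 1 [sub_eq_zero.mp h]
      rw [← Complex.exp_add, neg_add_cancel, Complex.exp_zero]
    · refine qPoch_ne_zero hq (fun n ↦ ?_) h
      have := hne (n + 1) 1 (Or.inl rfl)
      rwa [show 2 * Real.pi * I * (((n + 1 : ℤ) : ℂ) * τ + ((1 : ℤ) : ℂ) * z)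
        = 2 * Real.pi * I * τ + 2 * Real.pi * I * z + n * (2 * Real.pi * I * τ) by push_cast; ring,
        Complex.exp_add, Complex.exp_add, Complex.exp_nat_mul] at this
    · refine qPoch_ne_zero hq (fun n ↦ ?_) h
      have := hne (n + 1) (-1) (Or.inr rfl)
      rwa [show 2 * Real.pi * I * (((n + 1 : ℤ) : ℂ) * τ + ((-1 : ℤ) : ℂ) * z)
        = 2 * Real.pi * I * τ + -(2 * Real.pi * I * z) + n * (2 * Real.pi * I * τ) by
          push_cast; ring,
        Complex.exp_add, Complex.exp_add, Complex.exp_nat_mul] at this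
    · exact pow_ne_zero 2 (qPoch_self_ne_zero hq) h
  · rintro ⟨m, n, rfl⟩
    have h1 : Function.Periodic (fun z ↦ primeForm z τ = 0) 1 := fun z ↦ by
      simp [primeForm_add_one]
    have h2 : Function.Periodic (fun z ↦ primeForm z τ = 0) τ := fun z ↦ by
      simp [primeForm_add_period hτ, Complex.exp_ne_zero]
    have e1 := h1.int_mul m ((n : ℂ) * τ)
    have e2 := h2.int_mul n 0
    simp only [mul_one, zero_add] at e1 e2
    rw [add_comm, e1, e2]
    exact primeForm_zero τ

end

/-! ### The modular transformation of the prime form -/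

section
open Complex Filter Topology

theorem neg_inv_im_pos {τ : ℂ} (hτ : 0 < τ.im) : 0 < (-1 / τ).im := by
  have := UpperHalfPlane.im_inv_neg_coe_pos ⟨τ, hτ⟩
  rwa [show -1 / τ = (-τ)⁻¹ by rw [neg_div, one_div, inv_neg]]

/-- A doubly periodic entire function is constant. -/
theorem apply_eq_apply_of_doubly_periodic {τ : ℂ} (hτ : 0 < τ.im) {f : ℂ → ℂ}
    (hf : Differentiable ℂ f) (h1 : Function.Periodic f 1) (h2 : Function.Periodic f τ) (z w : ℂ) :
    f z = f w := by
  refine hf.apply_eq_apply_of_bounded ?_ z w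
  set g : ℝ × ℝ → ℂ := fun p ↦ f (p.1 + p.2 * τ) with hg
  have hgc : Continuous g := hf.continuous.comp (by fun_prop)
  have hK : IsCompact (Set.Icc (0 : ℝ) 1 ×ˢ Set.Icc (0 : ℝ) 1) := isCompact_Icc.prod isCompact_Icc
  refine ((hK.image hgc).isBounded).subset ?_
  rintro _ ⟨z, rfl⟩
  set y : ℝ := z.im / τ.im with hy
  set x : ℝ := z.re - y * τ.re with hx
  have hz : z = x + y * τ := by
    apply Complex.ext
    · simp [hx]
    · simp [hy, hτ.ne']
  refine ⟨(Int.fract x, Int.fract y), ⟨⟨Int.fract_nonneg _, (Int.fract_lt_one _).le⟩,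
    ⟨Int.fract_nonneg _, (Int.fract_lt_one _).le⟩⟩, ?_⟩
  have e1 := h1.int_mul ⌊x⌋ ((Int.fract x : ℝ) + (Int.fract y : ℝ) * τ)
  have e2 := h2.int_mul ⌊y⌋ ((Int.fract x : ℝ) + (Int.fract y : ℝ) * τ + ⌊x⌋ * 1)
  change f _ = f _
  rw [← e1, ← e2]
  congr 1
  have hx' : (x : ℂ) = (⌊x⌋ : ℂ) + (Int.fract x : ℝ) := by
    exact_mod_cast (Int.floor_add_fract x).symm
  have hy' : (y : ℂ) = (⌊y⌋ : ℂ) + (Int.fract y : ℝ) := by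
    exact_mod_cast (Int.floor_add_fract y).symm
  rw [hz, hx', hy']
  ring

/-- Two entire functions with the same nonvanishing multipliers along `1` and `τ` agree if both
vanish on the lattice, the second one only there, with the same nonzero derivative at `0`: their
quotient is an entire doubly periodic function. -/
theorem eq_of_quasi_periodic {τ : ℂ} (hτ : 0 < τ.im) {F G a b : ℂ → ℂ}
    (hF : Differentiable ℂ F) (hG : Differentiable ℂ G)
    (ha : ∀ z, a z ≠ 0) (hb : ∀ z, b z ≠ 0)
    (hF1 : ∀ z, F (z + 1) = a z * F z) (hG1 : ∀ z, G (z + 1) = a z * G z)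
    (hF2 : ∀ z, F (z + τ) = b z * F z) (hG2 : ∀ z, G (z + τ) = b z * G z)
    (hG0 : ∀ z, G z = 0 → ∃ m n : ℤ, z = m + n * τ) (hF0 : F 0 = 0) (hG00 : G 0 = 0) {c : ℂ}
    (hc : c ≠ 0) (hFd : HasDerivAt F c 0) (hGd : HasDerivAt G c 0) : F = G := by
  set R : ℂ → ℂ := fun z ↦ if G z = 0 then 1 else F z / G z with hR
  have hR1 : Function.Periodic R 1 := fun z ↦ by
    simp only [hR, hF1, hG1, mul_eq_zero, ha, false_or, mul_div_mul_left _ _ (ha z)]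
  have hR2 : Function.Periodic R τ := fun z ↦ by
    simp only [hR, hF2, hG2, mul_eq_zero, hb, false_or, mul_div_mul_left _ _ (hb z)]
  have hR0 : DifferentiableAt ℂ R 0 := by
    have dF : DifferentiableAt ℂ (dslope F 0) 0 :=
      ((Complex.differentiableOn_dslope univ_mem).mpr hF.differentiableOn).differentiableAt univ_mem
    have dG : DifferentiableAt ℂ (dslope G 0) 0 :=
      ((Complex.differentiableOn_dslope univ_mem).mpr hG.differentiableOn).differentiableAt univ_mem
    have hF' : dslope F 0 0 = c := by rw [dslope_same, hFd.deriv]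
    have hG' : dslope G 0 0 = c := by rw [dslope_same, hGd.deriv]
    have hG'0 : dslope G 0 0 ≠ 0 := hG' ▸ hc
    refine (dF.div dG hG'0).congr_of_eventuallyEq ?_
    filter_upwards [dG.continuousAt.eventually_ne hG'0] with z hz
    rcases eq_or_ne z 0 with rfl | hz0
    · rw [Pi.div_apply, hF', hG', div_self hc]
      simp [hR, hG00]
    · have sF : dslope F 0 z = F z / z := by
        rw [dslope_of_ne _ hz0, slope_def_field, hF0, sub_zero, sub_zero]
      have sG : dslope G 0 z = G z / z := by
        rw [dslope_of_ne _ hz0, slope_def_field, hG00, sub_zero, sub_zero]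
      have hGz : G z ≠ 0 := fun h ↦ hz (by rw [sG, h, zero_div])
      simp only [hR, hGz, if_false, Pi.div_apply, sF, sG]
      rw [div_div_div_cancel_right₀ hz0]
  have hRd : Differentiable ℂ R := by
    intro z
    by_cases hz : G z = 0
    · obtain ⟨m, n, rfl⟩ := hG0 z hz
      have e : R = fun w ↦ R (w - (m + n * τ)) := by
        funext w
        have e1 := hR1.sub_int_mul_eq (x := w) m
        have e2 := hR2.sub_int_mul_eq (x := w - m * 1) n
        rw [mul_one] at e1 e2
        rw [← sub_sub, e2, e1]
      rw [e]
      refine DifferentiableAt.comp (𝕜 := ℂ) (g := R) _ ?_ (by fun_prop)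
      simpa using hR0
    · refine ((hF z).div (hG z) hz).congr_of_eventuallyEq ?_
      filter_upwards [(hG z).continuousAt.eventually_ne hz] with w hw
      simp [hR, hw]
  have hFG : ∀ z, G z ≠ 0 → F z = G z := fun z hz ↦ by
    have := apply_eq_apply_of_doubly_periodic hτ hRd hR1 hR2 z 0
    simpa [hR, hz, hG00, div_eq_one_iff_eq] using this
  have hF1' : Function.Periodic (fun z ↦ F z = 0) 1 := fun z ↦ by simp [hF1, ha]
  have hF2' : Function.Periodic (fun z ↦ F z = 0) τ := fun z ↦ by simp [hF2, hb]
  funext z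
  by_cases hz : G z = 0
  · rw [hz]
    obtain ⟨m, n, rfl⟩ := hG0 z hz
    have e1 := hF1'.int_mul m ((n : ℂ) * τ)
    have e2 := hF2'.int_mul n 0
    simp only [mul_one, zero_add] at e1 e2
    rw [add_comm, e1, e2]
    exact hF0
  · exact hFG z hz

theorem primeForm_neg_inv {τ : ℂ} (hτ : 0 < τ.im) (z : ℂ) :
    primeForm (z / τ) (-1 / τ) * τ = cexp (Real.pi * I * z ^ 2 / τ) * primeForm z τ := by
  have hτ0 : τ ≠ 0 := by rintro rfl; simp at hτ
  have hτ' := neg_inv_im_pos hτ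
  have key := eq_of_quasi_periodic hτ (c := 2 * Real.pi * I)
    (F := fun z ↦ cexp (-(Real.pi * I * z ^ 2 / τ)) * (primeForm (z / τ) (-1 / τ) * τ))
    (G := fun z ↦ primeForm z τ) (a := fun _ ↦ -1)
    (b := fun z ↦ -cexp (-(Real.pi * I * τ) - 2 * Real.pi * I * z)) ?_
    (differentiable_primeForm hτ) (fun _ ↦ by simp) (fun _ ↦ by simp [Complex.exp_ne_zero])
    ?_ (fun z ↦ by rw [primeForm_add_one]; ring) ?_ (primeForm_add_period hτ)
    (fun z hz ↦ (primeForm_eq_zero_iff hτ).mp hz) (by simp [primeForm_zero]) (primeForm_zero τ)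
    Complex.two_pi_I_ne_zero ?_ (hasDerivAt_primeForm_zero hτ)
  · rw [← congrFun key z, ← mul_assoc, ← Complex.exp_add, add_neg_cancel, Complex.exp_zero, one_mul]
  · have : Differentiable ℂ fun z ↦ primeForm (z / τ) (-1 / τ) :=
      (differentiable_primeForm hτ').comp (by fun_prop)
    fun_prop
  · intro z
    have h := primeForm_add_period hτ' ((z + 1) / τ)
    rw [show (z + 1) / τ + -1 / τ = z / τ by ring] at h
    rw [h]
    have : cexp (-(Real.pi * I * z ^ 2 / τ)) = cexp (-(Real.pi * I * (z + 1) ^ 2 / τ))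
        * (cexp (-(Real.pi * I * (-1 / τ)) - 2 * Real.pi * I * ((z + 1) / τ)))⁻¹ := by
      rw [← Complex.exp_neg, ← Complex.exp_add]
      congr 1
      field_simp
      ring
    rw [this]
    field_simp [Complex.exp_ne_zero]
  · intro z
    rw [show (z + τ) / τ = z / τ + 1 by field_simp, primeForm_add_one]
    have : cexp (-(Real.pi * I * (z + τ) ^ 2 / τ)) = cexp (-(Real.pi * I * z ^ 2 / τ))
        * cexp (-(Real.pi * I * τ) - 2 * Real.pi * I * z) := by
      rw [← Complex.exp_add]
      congr 1
      field_simp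
      ring
    rw [this]
    ring
  · have h1 : HasDerivAt (fun z ↦ cexp (-(Real.pi * I * z ^ 2 / τ)))
        (deriv (fun z ↦ cexp (-(Real.pi * I * z ^ 2 / τ))) 0) 0 :=
      DifferentiableAt.hasDerivAt (by fun_prop)
    have h2 : HasDerivAt (fun z ↦ primeForm (z / τ) (-1 / τ) * τ)
        (2 * Real.pi * I * (1 / τ) * τ) 0 := by
      have h := hasDerivAt_primeForm_zero hτ'
      rw [show (0 : ℂ) = 0 / τ by simp] at h
      exact ((h.comp (0 : ℂ) ((hasDerivAt_id' (0 : ℂ)).div_const τ)).mul_const τ)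
    refine (h1.mul h2).congr_deriv ?_
    simp only [zero_div, primeForm_zero, zero_mul, mul_zero, zero_add, ne_eq, OfNat.ofNat_ne_zero,
      not_false_eq_true, zero_pow, neg_zero, Complex.exp_zero, one_mul]
    field_simp

theorem primeForm_period_add_one (z τ : ℂ) : primeForm z (τ + 1) = primeForm z τ := by
  have : cexp (2 * Real.pi * I * (τ + 1)) = cexp (2 * Real.pi * I * τ) := by
    rw [mul_add, Complex.exp_add, mul_one, Complex.exp_two_pi_mul_I, mul_one]
  simp only [primeForm, this]

end

/-! ### Klein forms -/

section
open Complex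
open UpperHalfPlane hiding I

/-- The Klein form `exp (π i v₀ (v₀ τ + v₁)) S(v₀ τ + v₁, τ)`, with `S` the prime form and an
arbitrary complex vector `v`. It is modular of weight `-1` when `SL(2, ℤ)` acts on `v` too. -/
noncomputable def kleinForm (v : Fin 2 → ℂ) (τ : ℍ) : ℂ :=
  cexp (Real.pi * I * v 0 * (v 0 * τ + v 1)) * primeForm (v 0 * τ + v 1) τ

/-- The action of `SL(2, ℤ)` on row vectors. -/
noncomputable def rowAct (v : Fin 2 → ℂ) (γ : SL(2, ℤ)) : Fin 2 → ℂ :=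
  Matrix.vecMul v (Matrix.SpecialLinearGroup.map (Int.castRingHom ℂ) γ).1

theorem rowAct_mul (v : Fin 2 → ℂ) (γ δ : SL(2, ℤ)) :
    rowAct v (γ * δ) = rowAct (rowAct v γ) δ := by
  simp [rowAct, Matrix.vecMul_vecMul]

theorem rowAct_one (v : Fin 2 → ℂ) : rowAct v 1 = v := by simp [rowAct]

theorem rowAct_zero (v : Fin 2 → ℂ) (γ : SL(2, ℤ)) :
    rowAct v γ 0 = v 0 * γ 0 0 + v 1 * γ 1 0 := by
  simp [rowAct, Matrix.vecMul, dotProduct, Fin.sum_univ_two]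

theorem rowAct_apply_one (v : Fin 2 → ℂ) (γ : SL(2, ℤ)) :
    rowAct v γ 1 = v 0 * γ 0 1 + v 1 * γ 1 1 := by
  simp [rowAct, Matrix.vecMul, dotProduct, Fin.sum_univ_two]

theorem kleinForm_slash_T (v : Fin 2 → ℂ) :
    kleinForm v ∣[(-1 : ℤ)] ModularGroup.T = kleinForm (rowAct v ModularGroup.T) := by
  ext τ
  rw [ModularForm.SL_slash_apply, ModularGroup.denom_apply, modular_T_smul]
  have h : (((1 : ℝ) +ᵥ τ : ℍ) : ℂ) = τ + 1 := by simp [add_comm]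
  have e0 : rowAct v ModularGroup.T 0 = v 0 := by rw [rowAct_zero]; simp [ModularGroup.T]
  have e1 : rowAct v ModularGroup.T 1 = v 0 + v 1 := by
    rw [rowAct_apply_one]; simp [ModularGroup.T]
  have ed : ((ModularGroup.T 1 0 : ℤ) : ℂ) * (τ : ℂ) + ((ModularGroup.T 1 1 : ℤ) : ℂ) = 1 := by
    simp [ModularGroup.T]
  simp only [kleinForm, h, e0, e1, ed, primeForm_period_add_one, one_zpow, mul_one]
  rw [show v 0 * ((τ : ℂ) + 1) + v 1 = v 0 * τ + (v 0 + v 1) by ring]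

theorem kleinForm_slash_S (v : Fin 2 → ℂ) :
    kleinForm v ∣[(-1 : ℤ)] ModularGroup.S = kleinForm (rowAct v ModularGroup.S) := by
  ext τ
  have hτ0 : (τ : ℂ) ≠ 0 := τ.ne_zero
  rw [ModularForm.SL_slash_apply, ModularGroup.denom_apply, modular_S_smul]
  have h : (-(τ : ℂ))⁻¹ = -1 / τ := by rw [neg_div, one_div, inv_neg]
  have e0 : rowAct v ModularGroup.S 0 = v 1 := by rw [rowAct_zero]; simp [ModularGroup.S]
  have e1 : rowAct v ModularGroup.S 1 = -v 0 := by rw [rowAct_apply_one]; simp [ModularGroup.S]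
  have ez : v 0 * (-1 / τ) + v 1 = (v 1 * τ + -v 0) / τ := by field_simp; ring
  have key := primeForm_neg_inv τ.im_pos (v 1 * τ + -v 0)
  simp only [kleinForm, h, e0, e1]
  have ed : ((ModularGroup.S 1 0 : ℤ) : ℂ) * (τ : ℂ) + ((ModularGroup.S 1 1 : ℤ) : ℂ) = τ := by
    simp [ModularGroup.S]
  rw [ed, ez, neg_neg, zpow_one, mul_assoc, key, ← mul_assoc, ← Complex.exp_add]
  congr 2
  field_simp
  ring

/-- Klein forms are permuted by the weight `-1` action of `SL(2, ℤ)`. -/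
theorem kleinForm_slash (γ : SL(2, ℤ)) (v : Fin 2 → ℂ) :
    kleinForm v ∣[(-1 : ℤ)] γ = kleinForm (rowAct v γ) := by
  have h : γ ∈ Subgroup.closure {ModularGroup.S, ModularGroup.T} := by
    simp [SpecialLinearGroup.SL2Z_generators]
  induction h using Subgroup.closure_induction generalizing v with
  | one => rw [SlashAction.slash_one, rowAct_one]
  | mem g hg =>
    rcases hg with rfl | rfl
    · exact kleinForm_slash_S v
    · exact kleinForm_slash_T v
  | mul g h _ _ ig ih => rw [SlashAction.slash_mul, ig, ih, rowAct_mul]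
  | inv g _ ig =>
    have := ig (rowAct v g⁻¹)
    rw [← rowAct_mul, inv_mul_cancel, rowAct_one] at this
    rw [← this, ← SlashAction.slash_mul, mul_inv_cancel, SlashAction.slash_one]

theorem kleinForm_smul (γ : SL(2, ℤ)) (v : Fin 2 → ℂ) (τ : ℍ) :
    kleinForm v (γ • τ) * ((γ 1 0 : ℂ) * τ + γ 1 1) = kleinForm (rowAct v γ) τ := by
  rw [← kleinForm_slash, ModularForm.SL_slash_apply, ModularGroup.denom_apply, neg_neg, zpow_one]

end

/-! ### Weight one: the logarithmic derivative of a Klein form -/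

section
open Complex

/-- Hecke's weight one form attached to a vector `v`: the logarithmic derivative of the prime form
at `z = v₀ τ + v₁`, made modular by the term `2 π i v₀`. -/
noncomputable def heckeForm (v : Fin 2 → ℂ) (τ : ℍ) : ℂ :=
  logDeriv (fun z ↦ primeForm z τ) (v 0 * τ + v 1) + 2 * Real.pi * I * v 0

theorem logDeriv_cexp_mul_comp {g l S : ℂ → ℂ} {t g' l' : ℂ} (hg : HasDerivAt g g' t)
    (hl : HasDerivAt l l' t) (hS : DifferentiableAt ℂ S (l t)) (h0 : S (l t) ≠ 0) :
    logDeriv (fun t ↦ cexp (g t) * S (l t)) t = g' + l' * logDeriv S (l t) := by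
  have h := hg.cexp.mul (hS.hasDerivAt.comp t hl)
  have e : logDeriv (fun t ↦ cexp (g t) * S (l t)) t
      = (cexp (g t) * g' * S (l t) + cexp (g t) * (deriv S (l t) * l')) / (cexp (g t) * S (l t)) := by
    rw [logDeriv_apply]
    exact congrArg (· / _) h.deriv
  rw [e, logDeriv_apply]
  have := Complex.exp_ne_zero (g t)
  field_simp

theorem kleinForm_eq_zero_iff {v : Fin 2 → ℂ} {τ : ℍ} :
    kleinForm v τ = 0 ↔ primeForm (v 0 * τ + v 1) τ = 0 := by
  simp [kleinForm, Complex.exp_ne_zero]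

theorem SL2_denom_ne_zero (γ : SL(2, ℤ)) (τ : ℍ) : (γ 1 0 : ℂ) * τ + γ 1 1 ≠ 0 := by
  rw [← ModularGroup.denom_apply]
  exact UpperHalfPlane.denom_ne_zero _ _

/-- The forms `heckeForm v` are permuted by the weight one action of `SL(2, ℤ)`: this is the
logarithmic derivative of the transformation law of `kleinForm v` with respect to `v₁`. -/
theorem heckeForm_smul (γ : SL(2, ℤ)) (v : Fin 2 → ℂ) (τ : ℍ)
    (h : kleinForm (rowAct v γ) τ ≠ 0) :
    heckeForm v (γ • τ) = ((γ 1 0 : ℂ) * τ + γ 1 1) * heckeForm (rowAct v γ) τ := by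
  set j : ℂ := (γ 1 0 : ℂ) * τ + γ 1 1 with hj
  have hj0 : j ≠ 0 := SL2_denom_ne_zero γ τ
  have h' : kleinForm v (γ • τ) ≠ 0 := fun h0 ↦ h (by rw [← kleinForm_smul, h0, zero_mul])
  rw [Ne, kleinForm_eq_zero_iff] at h h'
  set x := rowAct v γ 0 with hx
  set y := rowAct v γ 1 with hy
  have hvx : v 0 = γ 1 1 * x - γ 1 0 * y := by
    have hdet : (γ 0 0 : ℂ) * γ 1 1 - γ 0 1 * γ 1 0 = 1 := by
      have := Matrix.SpecialLinearGroup.det_coe γ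
      rw [Matrix.det_fin_two] at this
      exact_mod_cast this
    rw [hx, hy, rowAct_zero, rowAct_apply_one]
    linear_combination -(v 0) * hdet
  have hfun : (fun t : ℂ ↦ cexp (Real.pi * I * v 0 * (v 0 * (γ • τ : ℍ) + (v 1 + t)))
        * (primeForm (v 0 * (γ • τ : ℍ) + (v 1 + t)) (γ • τ : ℍ)) * j)
      = fun t : ℂ ↦ cexp (Real.pi * I * (x + γ 1 0 * t) * ((x + γ 1 0 * t) * τ + (y + γ 1 1 * t)))
        * primeForm ((x + γ 1 0 * t) * τ + (y + γ 1 1 * t)) τ := by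
    funext t
    have := kleinForm_smul γ ![v 0, v 1 + t] τ
    simp only [kleinForm, Matrix.cons_val_zero, Matrix.cons_val_one, rowAct_zero,
      rowAct_apply_one] at this
    rw [hj, this, hx, hy, rowAct_zero, rowAct_apply_one]
    ring_nf
  have hl := congrArg (logDeriv · 0) hfun
  beta_reduce at hl
  rw [logDeriv_mul_const _ _ hj0] at hl
  have d1 : HasDerivAt (fun t : ℂ ↦ v 0 * (γ • τ : ℍ) + (v 1 + t)) 1 0 :=
    ((hasDerivAt_id' (0 : ℂ)).const_add _).const_add _
  have d2 : HasDerivAt (fun t : ℂ ↦ x + γ 1 0 * t) (γ 1 0) 0 := by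
    simpa using ((hasDerivAt_id' (0 : ℂ)).const_mul (γ 1 0 : ℂ)).const_add x
  have d3 : HasDerivAt (fun t : ℂ ↦ y + γ 1 1 * t) (γ 1 1) 0 := by
    simpa using ((hasDerivAt_id' (0 : ℂ)).const_mul (γ 1 1 : ℂ)).const_add y
  have d4 : HasDerivAt (fun t : ℂ ↦ (x + γ 1 0 * t) * τ + (y + γ 1 1 * t)) j 0 :=
    (d2.mul_const (τ : ℂ)).add d3
  have d5 : HasDerivAt
      (fun t : ℂ ↦ Real.pi * I * (x + γ 1 0 * t) * ((x + γ 1 0 * t) * τ + (y + γ 1 1 * t)))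
      (Real.pi * I * γ 1 0 * (x * τ + y) + Real.pi * I * x * j) 0 := by
    refine ((d2.const_mul (Real.pi * I : ℂ)).mul d4).congr_deriv ?_
    simp
  rw [logDeriv_cexp_mul_comp (S := fun z ↦ primeForm z (γ • τ : ℍ))
      (d1.const_mul (Real.pi * I * v 0)) d1
      (differentiable_primeForm (γ • τ).im_pos _) (by simpa using h'),
    logDeriv_cexp_mul_comp (S := fun z ↦ primeForm z τ)
      d5 d4
      (differentiable_primeForm τ.im_pos _) (by simpa using h)] at hl
  simp only [mul_zero, add_zero, mul_one, one_mul] at hl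
  rw [heckeForm, heckeForm, ← hx, ← hy]
  rw [hvx] at hl ⊢
  linear_combination hl

theorem logDeriv_comp_add_const (f : ℂ → ℂ) (a z : ℂ) :
    logDeriv (fun z ↦ f (z + a)) z = logDeriv f (z + a) := by
  simp only [logDeriv_apply, deriv_comp_add_const]

theorem heckeForm_add_int_right (x y : ℂ) (m : ℤ) (τ : ℍ) :
    heckeForm ![x, y + m] τ = heckeForm ![x, y] τ := by
  have hper : Function.Periodic (logDeriv fun z ↦ primeForm z τ) 1 := by
    intro z
    rw [← logDeriv_comp_add_const (fun z ↦ primeForm z τ)]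
    have : (fun z ↦ primeForm (z + 1) τ) = fun z ↦ primeForm z τ * (-1) := by
      funext z; rw [primeForm_add_one]; ring
    rw [this, logDeriv_mul_const _ _ (by norm_num)]
  have := hper.int_mul m (x * τ + y)
  simp only [heckeForm, Matrix.cons_val_zero, Matrix.cons_val_one]
  rw [← this, mul_one, add_assoc]

theorem heckeForm_add_one_left {x y : ℂ} {τ : ℍ} (h : primeForm (x * τ + y) τ ≠ 0) :
    heckeForm ![x + 1, y] τ = heckeForm ![x, y] τ := by
  have hfun : (fun z ↦ primeForm (z + τ) τ) = fun z ↦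
      cexp (-(Real.pi * I * τ) - 2 * Real.pi * I * z) * primeForm z τ * (-1) := by
    funext z
    rw [primeForm_add_period τ.im_pos]; ring
  set z := x * τ + y with hz
  have d : HasDerivAt (fun z : ℂ ↦ -(Real.pi * I * τ) - 2 * Real.pi * I * z)
      (-(2 * Real.pi * I * 1)) z := ((hasDerivAt_id' z).const_mul _).const_sub _
  have key : logDeriv (fun z ↦ primeForm z τ) (z + τ)
      = logDeriv (fun z ↦ primeForm z τ) z - 2 * Real.pi * I := by
    rw [← logDeriv_comp_add_const (fun z ↦ primeForm z τ), hfun,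
      logDeriv_mul_const _ _ (by norm_num),
      logDeriv_cexp_mul_comp (S := fun z ↦ primeForm z τ) d (hasDerivAt_id' z)
        (differentiable_primeForm τ.im_pos z) h]
    ring
  simp only [heckeForm, Matrix.cons_val_zero, Matrix.cons_val_one]
  rw [show (x + 1) * (τ : ℂ) + y = z + τ by rw [hz]; ring, key]
  ring

theorem primeForm_add_int_left_eq_zero_iff (x y : ℂ) (k : ℤ) (τ : ℍ) :
    primeForm ((x + k) * τ + y) τ = 0 ↔ primeForm (x * τ + y) τ = 0 := by
  have h2 : Function.Periodic (fun z ↦ primeForm z τ = 0) τ := fun z ↦ by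
    simp [primeForm_add_period τ.im_pos, Complex.exp_ne_zero]
  have := h2.int_mul k (x * τ + y)
  rw [show (x + k) * (τ : ℂ) + y = x * τ + y + k * τ by ring]
  exact iff_of_eq this

theorem heckeForm_add_int_left {x y : ℂ} {τ : ℍ} (h : primeForm (x * τ + y) τ ≠ 0) (k : ℤ) :
    heckeForm ![x + k, y] τ = heckeForm ![x, y] τ := by
  classical
  have hper : Function.Periodic
      (fun x ↦ if primeForm (x * τ + y) τ = 0 then 0 else heckeForm ![x, y] τ) 1 := by
    intro x
    have hz := primeForm_add_int_left_eq_zero_iff x y 1 τ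
    rw [Int.cast_one] at hz
    beta_reduce
    by_cases h0 : primeForm (x * τ + y) τ = 0
    · rw [if_pos h0, if_pos (hz.mpr h0)]
    · rw [if_neg h0, if_neg (hz.not.mpr h0), heckeForm_add_one_left h0]
  have := hper.int_mul k x
  simpa [h, primeForm_add_int_left_eq_zero_iff] using this

end

/-! ### Level `p` -/

section
open Complex

/-- The point `p τ` of the upper half plane. -/
noncomputable def levelPoint (p : ℕ) [NeZero p] (τ : ℍ) : ℍ :=
  ⟨p * τ, by
    have : (0 : ℝ) < p := by exact_mod_cast NeZero.pos p
    simpa using mul_pos this τ.im_pos⟩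

theorem coe_levelPoint (p : ℕ) [NeZero p] (τ : ℍ) : (levelPoint p τ : ℂ) = p * τ := rfl

/-- The matrix `(a, p b; c / p, d)`, through which `γ = (a, b; c, d) ∈ Γ₀(p)` acts on `p τ`. -/
noncomputable def levelConj {p : ℕ} (γ : CongruenceSubgroup.Gamma0 p) : SL(2, ℤ) :=
  ⟨!![(γ : SL(2, ℤ)) 0 0, p * (γ : SL(2, ℤ)) 0 1; (γ : SL(2, ℤ)) 1 0 / p, (γ : SL(2, ℤ)) 1 1], by
    have h : ((γ : SL(2, ℤ)) 1 0 : ℤ) / p * p = (γ : SL(2, ℤ)) 1 0 := Int.ediv_mul_cancel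
      ((ZMod.intCast_zmod_eq_zero_iff_dvd _ _).mp (CongruenceSubgroup.Gamma0_mem.mp γ.2))
    have hdet := Matrix.SpecialLinearGroup.det_coe (γ : SL(2, ℤ))
    rw [Matrix.det_fin_two] at hdet
    rw [Matrix.det_fin_two_of]
    linear_combination hdet - (γ : SL(2, ℤ)) 0 1 * h⟩

theorem levelConj_lower {p : ℕ} (γ : CongruenceSubgroup.Gamma0 p) :
    ((levelConj γ 1 0 : ℤ) : ℂ) * p = (γ : SL(2, ℤ)) 1 0 := by
  have h : ((γ : SL(2, ℤ)) 1 0 : ℤ) / p * p = (γ : SL(2, ℤ)) 1 0 := Int.ediv_mul_cancel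
      ((ZMod.intCast_zmod_eq_zero_iff_dvd _ _).mp (CongruenceSubgroup.Gamma0_mem.mp γ.2))
  have e : (levelConj γ 1 0 : ℤ) = (γ : SL(2, ℤ)) 1 0 / p := rfl
  rw [e]
  exact_mod_cast h

theorem levelConj_denom {p : ℕ} [NeZero p] (γ : CongruenceSubgroup.Gamma0 p) (τ : ℍ) :
    ((levelConj γ 1 0 : ℤ) : ℂ) * levelPoint p τ + (levelConj γ 1 1 : ℤ)
      = ((γ : SL(2, ℤ)) 1 0 : ℂ) * τ + (γ : SL(2, ℤ)) 1 1 := by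
  rw [coe_levelPoint, ← mul_assoc, levelConj_lower]
  rfl

theorem coe_SL2_smul (γ : SL(2, ℤ)) (τ : ℍ) :
    ((γ • τ : ℍ) : ℂ) = ((γ 0 0 : ℂ) * τ + γ 0 1) / ((γ 1 0 : ℂ) * τ + γ 1 1) := by
  rw [UpperHalfPlane.specialLinearGroup_apply]
  simp

theorem levelPoint_smul {p : ℕ} [NeZero p] (γ : CongruenceSubgroup.Gamma0 p) (τ : ℍ) :
    levelPoint p ((γ : SL(2, ℤ)) • τ) = levelConj γ • levelPoint p τ := by
  apply UpperHalfPlane.ext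
  rw [coe_SL2_smul, levelConj_denom, coe_levelPoint, coe_SL2_smul, coe_levelPoint]
  have e0 : (levelConj γ 0 0 : ℤ) = (γ : SL(2, ℤ)) 0 0 := rfl
  have e1 : (levelConj γ 0 1 : ℤ) = p * (γ : SL(2, ℤ)) 0 1 := rfl
  rw [e0, e1]
  push_cast
  ring

/-- The level `p` Klein form with characteristic `(g / p, 0)`. -/
noncomputable def levelKlein (p : ℕ) [NeZero p] (g : ℤ) (τ : ℍ) : ℂ :=
  kleinForm ![g / p, 0] (levelPoint p τ)

/-- The level `p` Hecke form with characteristic `(g / p, 0)`. -/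
noncomputable def levelHecke (p : ℕ) [NeZero p] (g : ℤ) (τ : ℍ) : ℂ :=
  heckeForm ![g / p, 0] (levelPoint p τ)

theorem rowAct_level {p : ℕ} [NeZero p] (γ : CongruenceSubgroup.Gamma0 p) (g : ℤ) :
    rowAct ![(g : ℂ) / p, 0] (levelConj γ)
      = ![(((γ : SL(2, ℤ)) 0 0 * g : ℤ) : ℂ) / p, 0 + (((γ : SL(2, ℤ)) 0 1 * g : ℤ) : ℂ)] := by
  have hp : (p : ℂ) ≠ 0 := NeZero.ne _
  have e0 : (levelConj γ 0 0 : ℤ) = (γ : SL(2, ℤ)) 0 0 := rfl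
  have e1 : (levelConj γ 0 1 : ℤ) = p * (γ : SL(2, ℤ)) 0 1 := rfl
  funext i
  fin_cases i
  · refine (rowAct_zero _ _).trans ?_
    rw [e0]
    simp
    ring
  · refine (rowAct_apply_one _ _).trans ?_
    rw [e1]
    simp
    field_simp

theorem kleinForm_add_int_right (x y : ℂ) (m : ℤ) (τ : ℍ) :
    kleinForm ![x, y + m] τ = (-1) ^ m * cexp (Real.pi * I * x * m) * kleinForm ![x, y] τ := by
  have key : ∀ (m : ℤ) (z : ℂ), primeForm (z + m) τ = (-1) ^ m * primeForm z τ := by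
    intro m
    induction m using Int.induction_on with
    | zero => simp
    | succ n ih =>
      intro z
      rw [zpow_add₀ (by norm_num), zpow_one]
      push_cast at ih ⊢
      rw [← add_assoc, primeForm_add_one, ih]
      ring
    | pred n ih =>
      intro z
      have := ih z
      rw [zpow_sub₀ (by norm_num), zpow_one]
      push_cast at this ⊢
      rw [show z + -(n : ℂ) = z + (-(n : ℂ) - 1) + 1 by ring, primeForm_add_one] at this
      linear_combination -this
  simp only [kleinForm, Matrix.cons_val_zero, Matrix.cons_val_one]
  rw [← add_assoc, key, mul_add, Complex.exp_add]
  ring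

theorem kleinForm_add_one_left (x : ℂ) (τ : ℍ) :
    kleinForm ![x + 1, 0] τ = -kleinForm ![x, 0] τ := by
  simp only [kleinForm, Matrix.cons_val_zero, Matrix.cons_val_one, add_zero]
  rw [show (x + 1) * (τ : ℂ) = x * τ + τ by ring, primeForm_add_period τ.im_pos,
    neg_mul, mul_neg, ← mul_assoc, ← Complex.exp_add]
  congr 3
  ring

theorem levelKlein_smul {p : ℕ} [NeZero p] (γ : CongruenceSubgroup.Gamma0 p) (g : ℤ) (τ : ℍ) :
    levelKlein p g ((γ : SL(2, ℤ)) • τ) * (((γ : SL(2, ℤ)) 1 0 : ℂ) * τ + (γ : SL(2, ℤ)) 1 1)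
      = (-1) ^ ((γ : SL(2, ℤ)) 0 1 * g)
        * cexp (Real.pi * I * ((γ : SL(2, ℤ)) 0 0 * (γ : SL(2, ℤ)) 0 1 * g ^ 2 / p))
        * levelKlein p ((γ : SL(2, ℤ)) 0 0 * g) τ := by
  rw [levelKlein, levelPoint_smul, ← levelConj_denom, kleinForm_smul, rowAct_level,
    kleinForm_add_int_right, levelKlein]
  congr 3
  push_cast
  ring

theorem primeForm_level_ne_zero {p : ℕ} [NeZero p] {g : ℤ} (hg : (g : ZMod p) ≠ 0) (τ : ℍ) :
    primeForm ((g : ℂ) / p * levelPoint p τ + 0) (levelPoint p τ) ≠ 0 := by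
  have hp : (p : ℂ) ≠ 0 := NeZero.ne _
  rw [Ne, primeForm_eq_zero_iff (levelPoint p τ).im_pos]
  rintro ⟨m, n, h⟩
  have him := congrArg Complex.im h
  rw [coe_levelPoint, add_zero, ← mul_assoc, div_mul_cancel₀ _ hp] at him
  simp only [Complex.mul_im, Complex.intCast_re, Complex.intCast_im, zero_mul, add_zero,
    Complex.add_im, zero_add, Complex.natCast_re, Complex.natCast_im] at him
  rw [← mul_assoc] at him
  have h2 := mul_right_cancel₀ τ.im_pos.ne' him
  have h3 : g = n * p := by exact_mod_cast h2
  apply hg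
  rw [h3]
  simp

theorem levelKlein_ne_zero {p : ℕ} [NeZero p] {g : ℤ} (hg : (g : ZMod p) ≠ 0) (τ : ℍ) :
    levelKlein p g τ ≠ 0 := by
  rw [levelKlein, Ne, kleinForm_eq_zero_iff]
  exact primeForm_level_ne_zero hg τ

theorem levelHecke_smul {p : ℕ} [NeZero p] (γ : CongruenceSubgroup.Gamma0 p) {g : ℤ}
    (hg : (((γ : SL(2, ℤ)) 0 0 * g : ℤ) : ZMod p) ≠ 0) (τ : ℍ) :
    levelHecke p g ((γ : SL(2, ℤ)) • τ)
      = (((γ : SL(2, ℤ)) 1 0 : ℂ) * τ + (γ : SL(2, ℤ)) 1 1)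
        * levelHecke p ((γ : SL(2, ℤ)) 0 0 * g) τ := by
  have h := levelKlein_ne_zero hg τ
  rw [levelHecke, levelPoint_smul, ← levelConj_denom, heckeForm_smul, rowAct_level,
    heckeForm_add_int_right, levelHecke]
  rw [rowAct_level, kleinForm_add_int_right]
  refine mul_ne_zero (mul_ne_zero (zpow_ne_zero _ (by norm_num)) (Complex.exp_ne_zero _)) h

theorem levelHecke_congr {p : ℕ} [NeZero p] {g h : ℤ} (hgh : (g : ZMod p) = h)
    (hh : (h : ZMod p) ≠ 0) (τ : ℍ) : levelHecke p g τ = levelHecke p h τ := by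
  have hp : (p : ℂ) ≠ 0 := NeZero.ne _
  obtain ⟨k, hk⟩ := (ZMod.intCast_eq_intCast_iff_dvd_sub h g p).mp hgh.symm
  have : (g : ℂ) / p = h / p + k := by
    field_simp
    have : g = h + p * k := by linarith
    exact_mod_cast this
  rw [levelHecke, this, heckeForm_add_int_left (primeForm_level_ne_zero hh τ), levelHecke]

theorem levelKlein_neg (p : ℕ) [NeZero p] (g : ℤ) (τ : ℍ) :
    levelKlein p (-g) τ = -levelKlein p g τ := by
  simp only [levelKlein, kleinForm, Matrix.cons_val_zero, Matrix.cons_val_one, add_zero]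
  push_cast
  rw [neg_div, neg_mul, primeForm_neg, mul_neg]
  congr 3
  ring

/-- `levelKlein p g` depends only on `± g` modulo `p`, up to sign. -/
theorem levelKlein_congr {p : ℕ} [NeZero p] {g h : ℤ}
    (hgh : (g : ZMod p) = h ∨ (g : ZMod p) = -h) :
    levelKlein p g = levelKlein p h ∨ levelKlein p g = -levelKlein p h := by
  have key : ∀ (k g : ℤ), levelKlein p (g + p * k) = levelKlein p g ∨
      levelKlein p (g + p * k) = -levelKlein p g := by
    have hp : (p : ℂ) ≠ 0 := NeZero.ne _
    have step : ∀ g : ℤ, levelKlein p (g + p) = -levelKlein p g := by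
      intro g
      funext τ
      rw [Pi.neg_apply, levelKlein, levelKlein, ← kleinForm_add_one_left]
      congr 2
      push_cast
      field_simp
    intro k
    induction k using Int.induction_on with
    | zero => intro g; simp
    | succ n ih =>
      intro g
      rw [mul_add, mul_one, ← add_assoc, step]
      rcases ih g with h | h <;> simp [h]
    | pred n ih =>
      intro g
      have := step (g + p * (-n - 1))
      rw [show g + p * (-n - 1) + (p : ℤ) = g + p * -n by ring] at this
      rcases ih g with h | h <;> rw [h] at this
      · right; rw [this, neg_neg]
      · left; exact (neg_injective this).symm
  rcases hgh with hgh | hgh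
  · obtain ⟨k, hk⟩ := (ZMod.intCast_eq_intCast_iff_dvd_sub h g p).mp hgh.symm
    rw [show g = h + p * k by linarith]
    exact key k h
  · rw [← Int.cast_neg] at hgh
    obtain ⟨k, hk⟩ := (ZMod.intCast_eq_intCast_iff_dvd_sub (-h) g p).mp hgh.symm
    rw [show g = -h + p * k by linarith]
    have hneg : levelKlein p (-h) = -levelKlein p h := funext fun τ ↦ levelKlein_neg p h τ
    rcases key k (-h) with h1 | h1 <;> rw [h1, hneg]
    · exact Or.inr rfl
    · exact Or.inl (neg_neg _)

end

/-! ### The Eisenstein series of weight one -/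

section
open Complex

theorem norm_nome_lt_one (τ : ℍ) : ‖nome τ‖ < 1 := norm_cexp_two_pi_lt_one τ.im_pos

theorem nome_ne_zero (τ : ℍ) : nome τ ≠ 0 := Complex.exp_ne_zero _

theorem logDeriv_qPoch_comp_exp {q c s : ℂ} (hq : ‖q‖ < 1) (z : ℂ)
    (h : ∀ n : ℕ, c * cexp (s * z) * q ^ n ≠ 1) :
    logDeriv (fun z ↦ qPoch (c * cexp (s * z)) q) z
      = -s * ∑' n : ℕ, c * cexp (s * z) * q ^ n / (1 - c * cexp (s * z) * q ^ n) := by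
  have d : HasDerivAt (fun z ↦ c * cexp (s * z)) (c * (cexp (s * z) * (s * 1))) z :=
    (((hasDerivAt_id' z).const_mul s).cexp).const_mul c
  have := logDeriv_comp (f := fun a ↦ qPoch a q) (g := fun z ↦ c * cexp (s * z))
    (differentiable_qPoch hq _) d.differentiableAt
  rw [Function.comp_def] at this
  rw [this, logDeriv_qPoch hq h, d.deriv, ← tsum_mul_right, ← tsum_mul_left]
  refine tsum_congr fun n ↦ ?_
  ring

theorem summable_lambert {a q : ℂ} (hq : ‖q‖ < 1) :
    Summable fun n : ℕ ↦ a * q ^ n / (1 - a * q ^ n) := by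
  refine summable_div_one_sub ?_ ?_
  · simpa [norm_mul, norm_pow] using
      (summable_geometric_of_lt_one (norm_nonneg q) hq).mul_left ‖a‖
  · simpa using (tendsto_pow_atTop_nhds_zero_of_norm_lt_one hq).const_mul a

/-- The logarithmic derivative of the prime form, as a Lambert series. -/
theorem logDeriv_primeForm {τ : ℂ} (hτ : 0 < τ.im) {z : ℂ} (h : primeForm z τ ≠ 0) {q w : ℂ}
    (hq : cexp (2 * Real.pi * I * τ) = q) (hw : cexp (2 * Real.pi * I * z) = w) :
    logDeriv (fun z ↦ primeForm z τ) z = -(2 * Real.pi * I) * (1 / 2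
      + ∑' n : ℕ, w * q ^ n / (1 - w * q ^ n) - ∑' n : ℕ, q / w * q ^ n / (1 - q / w * q ^ n)) := by
  have hq1 := norm_cexp_two_pi_lt_one hτ
  have hne := h
  rw [hq] at hq1
  rw [primeForm, hq, div_ne_zero_iff, mul_ne_zero_iff, mul_ne_zero_iff] at hne
  obtain ⟨⟨h1, h2, h3⟩, h4⟩ := hne
  have hv : cexp (-(2 * Real.pi * I * z)) = w⁻¹ := by rw [Complex.exp_neg, hw]
  have hw0 : w ≠ 0 := hw ▸ Complex.exp_ne_zero _
  set u := cexp (Real.pi * I * z) with hu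
  have hu0 : u ≠ 0 := Complex.exp_ne_zero _
  have huw : u ^ 2 = w := by rw [hu, ← hw, ← Complex.exp_nat_mul]; congr 1; push_cast; ring
  have hw1 : 1 - w ≠ 0 := by
    intro h0
    apply h1
    have hu1 : u * u = 1 := by rw [← sq, huw]; exact (sub_eq_zero.mp h0).symm
    rw [Complex.exp_neg, ← hu]
    exact sub_eq_zero.mpr (eq_inv_of_mul_eq_one_left hu1)
  have nz : ∀ {a : ℂ}, qPoch a q ≠ 0 → ∀ n : ℕ, a * q ^ n ≠ 1 := by
    intro a ha n hn
    apply ha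
    exact tprod_of_exists_eq_zero ⟨n, by rw [hn, sub_self]⟩
  -- the three factors
  have d1 : DifferentiableAt ℂ (fun z ↦ cexp (Real.pi * I * z) - cexp (-(Real.pi * I * z))) z := by
    fun_prop
  have d2 : DifferentiableAt ℂ (fun z ↦ qPoch (q * cexp (2 * Real.pi * I * z)) q) z :=
    ((differentiable_qPoch hq1).comp (by fun_prop :
      Differentiable ℂ fun z ↦ q * cexp (2 * Real.pi * I * z))) z
  have d3 : DifferentiableAt ℂ (fun z ↦ qPoch (q * cexp (-(2 * Real.pi * I * z))) q) z :=
    ((differentiable_qPoch hq1).comp (by fun_prop :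
      Differentiable ℂ fun z ↦ q * cexp (-(2 * Real.pi * I * z)))) z
  have l1 : logDeriv (fun z ↦ cexp (Real.pi * I * z) - cexp (-(Real.pi * I * z))) z
      = -(2 * Real.pi * I) * (1 / 2 + w / (1 - w)) := by
    have hd := (((hasDerivAt_id' z).const_mul (Real.pi * I : ℂ)).cexp).sub
      (((hasDerivAt_id' z).const_mul (Real.pi * I : ℂ)).neg.cexp)
    rw [logDeriv_apply, show deriv (fun z ↦ cexp (Real.pi * I * z) - cexp (-(Real.pi * I * z))) z
      = _ from hd.deriv]
    rw [Complex.exp_neg, ← hu] at h1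
    simp only [Pi.neg_apply, mul_one, Complex.exp_neg, ← hu, ← huw]
    rw [← huw] at hw1
    have h1' : u - u⁻¹ = -(1 - u ^ 2) / u := by field_simp; ring
    rw [h1']
    field_simp
    ring
  have l2 : logDeriv (fun z ↦ qPoch (q * cexp (2 * Real.pi * I * z)) q) z
      = -(2 * Real.pi * I) * ∑' n : ℕ, w * q ^ (n + 1) / (1 - w * q ^ (n + 1)) := by
    rw [logDeriv_qPoch_comp_exp hq1 z (nz h2), hw]
    congr 1
    refine tsum_congr fun n ↦ ?_
    rw [show q * w * q ^ n = w * q ^ (n + 1) by ring]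
  have l3 : logDeriv (fun z ↦ qPoch (q * cexp (-(2 * Real.pi * I * z))) q) z
      = (2 * Real.pi * I) * ∑' n : ℕ, q / w * q ^ n / (1 - q / w * q ^ n) := by
    have h3' := nz h3
    have hs : ∀ z : ℂ, -(2 * Real.pi * I * z) = -(2 * Real.pi * I) * z := fun z ↦ by ring
    simp only [hs] at hv h3' ⊢
    rw [logDeriv_qPoch_comp_exp hq1 z h3', hv, neg_neg, ← div_eq_mul_inv]
  have e : (fun z ↦ primeForm z τ) = fun z ↦ (cexp (Real.pi * I * z) - cexp (-(Real.pi * I * z)))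
    * (qPoch (q * cexp (2 * Real.pi * I * z)) q * qPoch (q * cexp (-(2 * Real.pi * I * z))) q)
    * (qPoch q q ^ 2)⁻¹ := by
    funext z; rw [primeForm, hq, div_eq_mul_inv]
  rw [e, logDeriv_mul_const _ _ (inv_ne_zero h4),
    logDeriv_mul (f := fun z ↦ cexp (Real.pi * I * z) - cexp (-(Real.pi * I * z)))
      (g := fun z ↦ qPoch (q * cexp (2 * Real.pi * I * z)) q
        * qPoch (q * cexp (-(2 * Real.pi * I * z))) q) z h1 (mul_ne_zero h2 h3) d1 (d2.mul d3),
    logDeriv_mul (f := fun z ↦ qPoch (q * cexp (2 * Real.pi * I * z)) q)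
      (g := fun z ↦ qPoch (q * cexp (-(2 * Real.pi * I * z))) q) z h2 h3 d2 d3, l1, l2, l3,
    (summable_lambert (a := w) hq1).tsum_eq_zero_add]
  simp only [pow_zero, mul_one]
  ring

/-- The partial Lambert series `∑ q^m / (1 - q^m)` over the integers `m ≥ 0` in the class `g`. The
class `g = 0` includes the junk term `m = 0`, which has the value `1 / 0 = 0`. -/
noncomputable def lambertClass (p : ℕ) (g : ZMod p) (τ : ℍ) : ℂ :=
  ∑' n : ℕ, nome τ ^ (g.val + p * n) / (1 - nome τ ^ (g.val + p * n))

theorem levelHecke_eq {p : ℕ} [NeZero p] {g : ZMod p} (hg : g ≠ 0) (τ : ℍ) :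
    levelHecke p g.val τ = 2 * Real.pi * I
      * (((g.val : ℂ) / p - 1 / 2) - lambertClass p g τ + lambertClass p (-g) τ) := by
  have hp : (p : ℂ) ≠ 0 := NeZero.ne _
  have hg' : (((g.val : ℕ) : ℤ) : ZMod p) ≠ 0 := by simpa using hg
  have hq : cexp (2 * Real.pi * I * levelPoint p τ) = nome τ ^ p := by
    rw [nome, ← Complex.exp_nat_mul, coe_levelPoint]; congr 1; ring
  have hw : cexp (2 * Real.pi * I * ((((g.val : ℕ) : ℤ) : ℂ) / p * levelPoint p τ + 0))
      = nome τ ^ g.val := by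
    rw [nome, ← Complex.exp_nat_mul, coe_levelPoint]
    congr 1
    push_cast
    field_simp
    ring
  have hv : nome τ ^ p / nome τ ^ g.val = nome τ ^ (-g).val := by
    have := NeZero.mk hg
    rw [ZMod.val_neg_of_ne_zero, pow_sub₀ _ (nome_ne_zero τ) (ZMod.val_lt g).le, div_eq_mul_inv]
  simp only [levelHecke, heckeForm, Matrix.cons_val_zero, Matrix.cons_val_one]
  rw [logDeriv_primeForm (levelPoint p τ).im_pos (primeForm_level_ne_zero hg' τ) hq hw, hv]
  simp only [lambertClass, pow_add, pow_mul]
  push_cast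
  ring

theorem summable_lambert_char {p : ℕ} (χ : DirichletCharacter ℂ p) (τ : ℍ) :
    Summable fun n : ℕ ↦ χ n * (nome τ ^ n / (1 - nome τ ^ n)) := by
  have h := summable_lambert (a := 1) (norm_nome_lt_one τ)
  simp only [one_mul] at h
  refine Summable.of_norm_bounded h.norm fun n ↦ ?_
  rw [norm_mul]
  exact mul_le_of_le_one_left (norm_nonneg _) (DirichletCharacter.norm_le_one χ _)

/-- The Eisenstein series `E_{1,χ}` is the `χ`-average of the weight one Hecke forms of level
`p`. -/
theorem sum_levelHecke {p : ℕ} [Fact p.Prime] {χ : DirichletCharacter ℂ p} (hχ : χ.Odd) (τ : ℍ) :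
    ∑ g : ZMod p, χ g * levelHecke p g.val τ
      = -(2 * Real.pi * I) * DirichletCharacter.LFunction χ 0 * twistedEisenstein 1 χ τ := by
  have hp : 1 < p := (Fact.out : p.Prime).one_lt
  have hL := LFunction_apply_zero_ne_zero hχ
  have h1 : ∀ g : ZMod p, χ g * levelHecke p g.val τ = 2 * Real.pi * I
      * (χ g * ((g.val : ℂ) / p - 1 / 2) - χ g * lambertClass p g τ
        + χ g * lambertClass p (-g) τ) := by
    intro g
    rcases eq_or_ne g 0 with rfl | hg
    · have : Nontrivial (ZMod p) := ZMod.nontrivial_iff.mpr hp.ne'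
      simp [MulChar.map_zero]
    · rw [levelHecke_eq hg]; ring
  have h2 : ∑ g : ZMod p, χ g * lambertClass p (-g) τ
      = -∑ g : ZMod p, χ g * lambertClass p g τ := by
    rw [← Finset.sum_neg_distrib, ← Equiv.sum_comp (Equiv.neg (ZMod p))]
    refine Finset.sum_congr rfl fun g _ ↦ ?_
    rw [Equiv.neg_apply, neg_neg, hχ.eval_neg, neg_mul]
  have h3 : ∑ g : ZMod p, χ g * lambertClass p g τ
      = ∑' n : ℕ+, χ ((n : ℕ) : ZMod p) * (nome τ ^ (n : ℕ) / (1 - nome τ ^ (n : ℕ))) := by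
    have hs := summable_lambert_char χ τ
    have e0 : χ ((0 : ℕ) : ZMod p) = 0 := by
      have : Nontrivial (ZMod p) := ZMod.nontrivial_iff.mpr hp.ne'
      simp [MulChar.map_zero]
    have h4 := tsum_zero_pnat_eq_tsum_nat hs
    rw [e0, zero_mul, zero_add] at h4
    rw [h4, Nat.sumByResidueClasses hs p]
    refine Finset.sum_congr rfl fun g _ ↦ ?_
    rw [lambertClass, ← tsum_mul_left]
    refine tsum_congr fun n ↦ ?_
    simp
  simp_rw [h1]
  rw [← Finset.mul_sum, Finset.sum_add_distrib, Finset.sum_sub_distrib, h2, h3,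
    ← neg_eq_iff_eq_neg.mpr (LFunction_apply_zero hp χ), twistedEisenstein]
  simp only [Nat.cast_one, sub_self, tsub_self, pow_zero, one_mul]
  generalize ∑' n : ℕ+, χ ((n : ℕ) : ZMod p) * (nome τ ^ (n : ℕ) / (1 - nome τ ^ (n : ℕ))) = T
  field_simp
  ring

end

/-! ### Families permuted by the diamond operators -/

section
open Filter Topology

theorem lowerRight_surjective (p : ℕ) [NeZero p] : Function.Surjective (lowerRight p) := by
  intro u
  have h : (((u⁻¹.1.val : ℤ) * (u.1.val : ℤ) : ℤ) : ZMod p) = ((1 : ℤ) : ZMod p) := by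
    push_cast
    rw [ZMod.natCast_zmod_val, ZMod.natCast_zmod_val]
    exact u.inv_mul
  obtain ⟨b, hb⟩ := (ZMod.intCast_eq_intCast_iff_dvd_sub _ _ p).mp h.symm
  let g : SL(2, ℤ) := ⟨!![(u⁻¹.1.val : ℤ), b; p, (u.1.val : ℤ)], by
    rw [Matrix.det_fin_two_of]
    linear_combination hb⟩
  have hg : ((g 1 0 : ℤ) : ZMod p) = 0 := by
    change (((p : ℕ) : ℤ) : ZMod p) = 0
    simp
  refine ⟨⟨g, CongruenceSubgroup.Gamma0_mem.mpr hg⟩, Units.ext ?_⟩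
  change ((((u.1.val : ℕ) : ℤ)) : ZMod p) = u
  rw [Int.cast_natCast, ZMod.natCast_zmod_val]

theorem lowerRightClass_surjective (p : ℕ) [NeZero p] :
    Function.Surjective (lowerRightClass p) :=
  (QuotientGroup.mk'_surjective _).comp (lowerRight_surjective p)

theorem upperLeft_mul_lowerRight {p : ℕ} (γ : CongruenceSubgroup.Gamma0 p) :
    (((γ : SL(2, ℤ)) 0 0 : ℤ) : ZMod p) * (((γ : SL(2, ℤ)) 1 1 : ℤ) : ZMod p) = 1 := by
  have hdet := Matrix.SpecialLinearGroup.det_coe (γ : SL(2, ℤ))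
  rw [Matrix.det_fin_two] at hdet
  have h := congrArg (Int.cast : ℤ → ZMod p) hdet
  push_cast at h
  rw [CongruenceSubgroup.Gamma0_mem.mp γ.2] at h
  linear_combination h

theorem diamond_neg {p : ℕ} (γ : CongruenceSubgroup.Gamma0 p) (f : ℍ → ℂ) :
    diamond γ (-f) = -diamond γ f := SlashAction.neg_slash _ _ _

theorem eq_or_eq_neg_symm {A : Type*} [InvolutiveNeg A] {a b : A} (h : a = b ∨ a = -b) :
    b = a ∨ b = -a :=
  h.imp Eq.symm fun h ↦ by rw [h, neg_neg]

theorem eq_or_eq_neg_trans {A : Type*} [InvolutiveNeg A] {a b c : A} (h : a = b ∨ a = -b)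
    (h' : b = c ∨ b = -c) : a = c ∨ a = -c := by
  rcases h with rfl | rfl
  · exact h'
  · rcases h' with rfl | rfl
    · exact Or.inr rfl
    · exact Or.inl (neg_neg _)

theorem diamond_congr {p : ℕ} (γ : CongruenceSubgroup.Gamma0 p) {f g : ℍ → ℂ}
    (h : f = g ∨ f = -g) : diamond γ f = diamond γ g ∨ diamond γ f = -diamond γ g := by
  rcases h with rfl | rfl
  · exact Or.inl rfl
  · exact Or.inr (diamond_neg γ g)

theorem apply_injective_of_mul_left_eq {G ι : Type*} [Group G] {c : ι → G}
    (hc : Function.Injective c) {g : G} {i j : ι} (h : g * c i = g * c j) : i = j :=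
  hc (mul_left_cancel h)

/-- A relation `R γ` on the index set that becomes multiplication by `π γ` in a group `G`, under a
bijection `c` and a surjective homomorphism `π`, is a permutation representation with image `G`. -/
theorem exists_permutation_representation {Γ G ι : Type*} [Group Γ] [Group G] {π : Γ →* G}
    (hπ : Function.Surjective π) {c : ι → G} (hc : Function.Bijective c) {R : Γ → ι → ι → Prop}
    (hR : ∀ γ i j, R γ i j ↔ π γ * c i = c j) :
    ∃ ρ : Γ →* Equiv.Perm ι, (∀ γ i j, R γ i j ↔ ρ γ i = j) ∧
      (∃ Φ : ρ.range ≃* G, ∀ γ, Φ (ρ.rangeRestrict γ) = π γ) ∧ Function.Bijective c ∧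
      ∀ γ i, c (ρ γ i) = π γ * c i := by
  set e : ι ≃ G := Equiv.ofBijective c hc with he
  set ψ : G →* Equiv.Perm ι :=
    (e.symm.permCongrHom : Equiv.Perm G →* Equiv.Perm ι).comp (MulAction.toPermHom G G) with hψ
  have hψ_apply : ∀ g i, c (ψ g i) = g * c i := fun g i ↦ e.apply_symm_apply _
  have hψ_inj : Function.Injective ψ := by
    intro g g' hgg
    obtain ⟨i, hi⟩ := hc.2 1
    have h1 := hψ_apply g i
    rw [hgg, hψ_apply, hi, mul_one, mul_one] at h1
    exact h1.symm
  have hrange : (ψ.comp π).range = ψ.range := by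
    rw [MonoidHom.range_comp, MonoidHom.range_eq_top.mpr hπ, ← MonoidHom.range_eq_map]
  refine ⟨ψ.comp π, fun γ i j ↦ ?_,
    ⟨(MulEquiv.subgroupCongr hrange).trans (MonoidHom.ofInjective hψ_inj).symm, fun γ ↦ ?_⟩, hc,
    fun γ i ↦ hψ_apply _ i⟩
  · rw [hR, ← hψ_apply, hc.1.eq_iff]
    rfl
  · rw [MulEquiv.trans_apply, MulEquiv.symm_apply_eq]
    rfl

/-- A family indexed through a bijection by `(ℤ/pℤ)ˣ / {±1}`, on which `⟨γ⟩` acts up to sign as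
multiplication by `[γ₂₂]`, is permuted up to sign as soon as exactly one member has a nonzero limit
along some filter: as the action is transitive, this one member suffices to see that all members
are distinct up to sign. -/
theorem permutedUpToSign_of_tendsto {p : ℕ} [NeZero p] {ι : Type} {f : ι → ℍ → ℂ}
    {c : ι → UnitsModSign p} (hc : Function.Bijective c)
    (hf : ∀ γ i j, lowerRightClass p γ * c i = c j →
      diamond γ (f i) = f j ∨ diamond γ (f i) = -f j)
    {l : Filter ℍ} [l.NeBot] {i₀ : ι} {a : ℂ} (ha : a ≠ 0) (h₀ : Tendsto (f i₀) l (𝓝 a))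
    (h : ∀ i, i ≠ i₀ → Tendsto (f i) l (𝓝 0)) : PermutedUpToSign p f c := by
  have hne : ∀ i j, f i = f j ∨ f i = -f j → i = j := by
    intro i j hij
    by_contra hcon
    -- move `i` to the distinguished index
    obtain ⟨δ, hδ⟩ := lowerRightClass_surjective p (c i₀ * (c i)⁻¹)
    obtain ⟨k, hk⟩ := hc.2 (lowerRightClass p δ * c j)
    have hi : lowerRightClass p δ * c i = c i₀ := by
      rw [hδ]; exact inv_mul_cancel_right _ _
    have hk0 : k ≠ i₀ := by
      rintro rfl
      rw [← hi] at hk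
      exact hcon (apply_injective_of_mul_left_eq hc.1 hk)
    have h3 : f i₀ = f k ∨ f i₀ = -f k :=
      eq_or_eq_neg_trans (eq_or_eq_neg_symm (hf δ i i₀ hi))
        (eq_or_eq_neg_trans (diamond_congr δ hij) (hf δ j k hk.symm))
    rcases h3 with h3 | h3
    · exact ha (tendsto_nhds_unique h₀ (h3 ▸ h k hk0))
    · have := (h k hk0).neg
      rw [neg_zero] at this
      exact ha (tendsto_nhds_unique h₀ (h3 ▸ this))
  refine exists_permutation_representation (lowerRightClass_surjective p) hc
    fun γ i j ↦ ⟨fun hij ↦ ?_, hf γ i j⟩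
  obtain ⟨k, hk⟩ := hc.2 (lowerRightClass p γ * c i)
  rw [← hk, hne k j (eq_or_eq_neg_trans (eq_or_eq_neg_symm (hf γ i k hk.symm)) hij)]

theorem tendsto_nome_atImInfty : Tendsto nome UpperHalfPlane.atImInfty (𝓝 0) := by
  rw [tendsto_zero_iff_norm_tendsto_zero]
  have h : ∀ τ : ℍ, ‖nome τ‖ = Real.exp (-(2 * Real.pi * τ.im)) := by
    intro τ
    rw [nome, Complex.norm_exp]
    simp
  simp only [h]
  refine Real.tendsto_exp_neg_atTop_nhds_zero.comp ?_
  exact (tendsto_comap (f := UpperHalfPlane.im)).const_mul_atTop (by positivity)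

/-! ### The sum of the Eisenstein series -/

theorem twistedEisenstein_smul {p : ℕ} [Fact p.Prime] {χ : DirichletCharacter ℂ p} (hχ : χ.Odd)
    (γ : CongruenceSubgroup.Gamma0 p) (τ : ℍ) :
    twistedEisenstein 1 χ ((γ : SL(2, ℤ)) • τ)
      = (((γ : SL(2, ℤ)) 1 0 : ℂ) * τ + (γ : SL(2, ℤ)) 1 1)
        * (χ (lowerRight p γ : ZMod p) * twistedEisenstein 1 χ τ) := by
  have hL := LFunction_apply_zero_ne_zero hχ
  set u : (ZMod p)ˣ := lowerRight p γ with hu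
  have hua : (((γ : SL(2, ℤ)) 0 0 : ℤ) : ZMod p) = (u⁻¹ : (ZMod p)ˣ) :=
    Units.eq_inv_of_mul_eq_one_right (upperLeft_mul_lowerRight γ)
  set j := (((γ : SL(2, ℤ)) 1 0 : ℂ) * τ + (γ : SL(2, ℤ)) 1 1) with hj
  have h1 : ∑ g : ZMod p, χ g * levelHecke p g.val ((γ : SL(2, ℤ)) • τ)
      = j * χ u * ∑ g : ZMod p, χ g * levelHecke p g.val τ := by
    rw [← Equiv.sum_comp (Units.mulLeft u⁻¹) (fun g : ZMod p ↦ χ g * levelHecke p g.val τ),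
      Finset.mul_sum]
    refine Finset.sum_congr rfl fun g _ ↦ ?_
    simp only [Units.mulLeft_apply]
    have hχu : χ (u : ZMod p) * χ ((u⁻¹ : (ZMod p)ˣ) : ZMod p) = 1 := by
      rw [← map_mul, Units.mul_inv, map_one]
    rcases eq_or_ne g 0 with rfl | hg
    · rw [mul_zero, MulChar.map_zero, zero_mul, zero_mul, mul_zero]
    · have hcast : (((γ : SL(2, ℤ)) 0 0 * (g.val : ℤ) : ℤ) : ZMod p)
          = (u⁻¹ : (ZMod p)ˣ) * g := by
        rw [Int.cast_mul, hua, Int.cast_natCast, ZMod.natCast_zmod_val]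
      have hne : ((u⁻¹ : (ZMod p)ˣ) : ZMod p) * g ≠ 0 := mul_ne_zero (Units.ne_zero _) hg
      rw [levelHecke_smul γ (by rw [hcast]; exact hne), ← hj,
        levelHecke_congr (h := ((((u⁻¹ : (ZMod p)ˣ) : ZMod p) * g).val : ℤ))
          (by rw [hcast, Int.cast_natCast, ZMod.natCast_zmod_val])
          (by rw [Int.cast_natCast, ZMod.natCast_zmod_val]; exact hne), map_mul]
      linear_combination (-(j * χ g *
        levelHecke p ((((u⁻¹ : (ZMod p)ˣ) : ZMod p) * g).val : ℤ) τ)) * hχu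
  rw [sum_levelHecke hχ, sum_levelHecke hχ] at h1
  have h2 : -(2 * Real.pi * Complex.I) * DirichletCharacter.LFunction χ 0 ≠ 0 :=
    mul_ne_zero (neg_ne_zero.mpr Complex.two_pi_I_ne_zero) hL
  apply mul_left_cancel₀ h2
  rw [h1]
  ring

theorem tendsto_twistedEisenstein {p : ℕ} [NeZero p] (χ : DirichletCharacter ℂ p) :
    Tendsto (twistedEisenstein 1 χ) UpperHalfPlane.atImInfty (𝓝 1) := by
  have hs : Summable fun n : ℕ+ ↦ 2 * (1 / 2 : ℝ) ^ (n : ℕ) :=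
    (summable_geometric_two.comp_injective PNat.coe_injective).mul_left 2
  have key : Tendsto (fun τ ↦ ∑' n : ℕ+, χ ((n : ℕ) : ZMod p) * (((n : ℕ) : ℂ) ^ (1 - 1)
      * nome τ ^ (n : ℕ) / (1 - nome τ ^ (n : ℕ)))) UpperHalfPlane.atImInfty
      (𝓝 (∑' _ : ℕ+, (0 : ℂ))) := by
    refine tendsto_tsum_of_dominated_convergence hs (fun n ↦ ?_) ?_
    · have h1 : Tendsto (fun τ ↦ nome τ ^ (n : ℕ)) UpperHalfPlane.atImInfty (𝓝 0) := by
        simpa [n.ne_zero] using tendsto_nome_atImInfty.pow (n : ℕ)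
      have h2 := ((h1.const_mul (((n : ℕ) : ℂ) ^ (1 - 1))).div (h1.const_sub 1)
        (by simp)).const_mul (χ ((n : ℕ) : ZMod p))
      simpa using h2
    · have h3 : ∀ᶠ τ in UpperHalfPlane.atImInfty, ‖nome τ‖ < 1 / 2 :=
        (tendsto_zero_iff_norm_tendsto_zero.mp tendsto_nome_atImInfty).eventually_lt_const
          (by norm_num)
      filter_upwards [h3] with τ hτ n
      have h4 : ‖nome τ ^ (n : ℕ)‖ ≤ (1 / 2) ^ (n : ℕ) := by
        rw [norm_pow]; exact pow_le_pow_left₀ (norm_nonneg _) hτ.le _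
      have h5 : 1 / 2 ≤ ‖1 - nome τ ^ (n : ℕ)‖ := by
        have := norm_sub_norm_le (1 : ℂ) (nome τ ^ (n : ℕ))
        rw [norm_one] at this
        have h6 : (1 / 2 : ℝ) ^ (n : ℕ) ≤ 1 / 2 :=
          pow_le_of_le_one (by norm_num) (by norm_num) n.ne_zero
        linarith
      rw [tsub_self, pow_zero, one_mul, norm_mul, norm_div]
      calc _ ≤ 1 * (‖nome τ ^ (n : ℕ)‖ / ‖1 - nome τ ^ (n : ℕ)‖) := by
            gcongr; exact DirichletCharacter.norm_le_one χ _
        _ ≤ 1 * ((1 / 2) ^ (n : ℕ) / (1 / 2)) := by gcongr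
        _ = _ := by ring
  rw [tsum_zero] at key
  have := (key.const_mul (2 / DirichletCharacter.LFunction χ (1 - ((1 : ℕ) : ℂ)))).const_add 1
  rwa [mul_zero, add_zero] at this

open Classical in
/-- The combination `2 / (p - 1) * ∑ χ(d) E_{1,χ}` over the odd primitive characters modulo `p`,
which is the image of `𝓔_p` under the diamond operator of `d`. -/
noncomputable def eisensteinTwist (p : ℕ) [NeZero p] (d : (ZMod p)ˣ) (τ : ℍ) : ℂ :=
  2 / ((p : ℂ) - 1) *
    ∑ χ ∈ (Finset.univ : Finset (DirichletCharacter ℂ p)).filter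
      (fun χ => χ.Odd ∧ χ.IsPrimitive), χ (d : ZMod p) * twistedEisenstein 1 χ τ

theorem eisensteinTwist_one (p : ℕ) [NeZero p] : eisensteinTwist p 1 = eisensteinSum p := by
  funext τ
  simp [eisensteinTwist, eisensteinSum]

open Classical in
theorem eisensteinTwist_neg {p : ℕ} [NeZero p] (d : (ZMod p)ˣ) :
    eisensteinTwist p (-d) = -eisensteinTwist p d := by
  funext τ
  rw [Pi.neg_apply, eisensteinTwist, eisensteinTwist, ← mul_neg, ← Finset.sum_neg_distrib]
  congr 1
  refine Finset.sum_congr rfl fun χ hχ ↦ ?_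
  rw [Finset.mem_filter] at hχ
  rw [Units.val_neg, hχ.2.1.eval_neg, neg_mul]

open Classical in
theorem diamond_eisensteinTwist {p : ℕ} [Fact p.Prime] (γ : CongruenceSubgroup.Gamma0 p)
    (d : (ZMod p)ˣ) : diamond γ (eisensteinTwist p d) = eisensteinTwist p (d * lowerRight p γ) := by
  funext τ
  rw [diamond_apply, eisensteinTwist, eisensteinTwist, mul_left_comm, Finset.mul_sum]
  congr 1
  refine Finset.sum_congr rfl fun χ hχ ↦ ?_
  rw [Finset.mem_filter] at hχ
  have hj := SL2_denom_ne_zero (γ : SL(2, ℤ)) τ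
  rw [twistedEisenstein_smul hχ.2.1, Units.val_mul, map_mul, zpow_neg_one]
  field_simp

theorem diamond_eisensteinSum {p : ℕ} [Fact p.Prime] (γ : CongruenceSubgroup.Gamma0 p) :
    diamond γ (eisensteinSum p) = eisensteinTwist p (lowerRight p γ) := by
  rw [← eisensteinTwist_one, diamond_eisensteinTwist, one_mul]

open Classical in
/-- Orthogonality of the odd characters modulo `p`. -/
theorem sum_odd_characters {p : ℕ} [Fact p.Prime] (d : (ZMod p)ˣ) :
    ∑ χ ∈ (Finset.univ : Finset (DirichletCharacter ℂ p)).filter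
      (fun χ => χ.Odd ∧ χ.IsPrimitive), χ (d : ZMod p)
      = ((p : ℂ) - 1) / 2 * ((if d = 1 then 1 else 0) - (if d = -1 then 1 else 0)) := by
  have hp : p.Prime := Fact.out
  have h1 : ∑ χ ∈ (Finset.univ : Finset (DirichletCharacter ℂ p)).filter
      (fun χ => χ.Odd ∧ χ.IsPrimitive), χ (d : ZMod p)
      = ∑ χ : DirichletCharacter ℂ p, (χ (d : ZMod p) - χ (-d : ZMod p)) / 2 := by
    rw [Finset.sum_filter]
    refine Finset.sum_congr rfl fun χ _ ↦ ?_
    rcases χ.even_or_odd with hχ | hχ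
    · rw [hχ.eval_neg, sub_self, zero_div, if_neg]
      rintro ⟨h, _⟩
      exact DirichletCharacter.Odd.not_even χ h hχ
    · rw [if_pos ⟨hχ, isPrimitive_of_ne_one hχ.ne_one⟩, hχ.eval_neg]
      ring
  have htot : (p.totient : ℂ) = p - 1 := by
    rw [Nat.totient_prime hp, Nat.cast_sub hp.one_le, Nat.cast_one]
  rw [h1, ← Finset.sum_div, Finset.sum_sub_distrib, DirichletCharacter.sum_characters_eq,
    DirichletCharacter.sum_characters_eq, htot]
  have e1 : ((d : ZMod p) = 1) ↔ d = 1 := Units.val_eq_one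
  have e2 : (-(d : ZMod p) = 1) ↔ d = -1 := by
    rw [neg_eq_iff_eq_neg, ← Units.val_one, ← Units.val_neg, Units.val_inj]
  simp only [e1, e2]
  split_ifs <;> ring

open Classical in
theorem tendsto_eisensteinTwist {p : ℕ} [Fact p.Prime] (d : (ZMod p)ˣ) :
    Tendsto (eisensteinTwist p d) UpperHalfPlane.atImInfty
      (𝓝 ((if d = 1 then 1 else 0) - (if d = -1 then 1 else 0))) := by
  have h : Tendsto (eisensteinTwist p d) UpperHalfPlane.atImInfty
      (𝓝 (2 / ((p : ℂ) - 1) * ∑ χ ∈ (Finset.univ : Finset (DirichletCharacter ℂ p)).filter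
      (fun χ => χ.Odd ∧ χ.IsPrimitive), χ (d : ZMod p) * 1)) :=
    (tendsto_finsetSum _ fun χ _ ↦ (tendsto_twistedEisenstein χ).const_mul _).const_mul _
  simp only [mul_one] at h
  have hp : (p : ℂ) - 1 ≠ 0 := by
    rw [sub_ne_zero]; exact_mod_cast (Fact.out : p.Prime).ne_one
  rw [sum_odd_characters] at h
  convert h using 2
  field_simp

theorem mk_eq_mk_iff_eq_or_eq_neg {p : ℕ} (a b : (ZMod p)ˣ) :
    (QuotientGroup.mk a : UnitsModSign p) = QuotientGroup.mk b ↔ a = b ∨ a = -b := by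
  rw [QuotientGroup.eq, Subgroup.mem_zpowers_iff]
  constructor
  · rintro ⟨k, hk⟩
    rcases Int.even_or_odd k with h | h
    · rw [h.neg_one_zpow] at hk
      exact Or.inl (inv_mul_eq_one.mp hk.symm)
    · rw [h.neg_one_zpow] at hk
      right
      rw [eq_inv_mul_iff_mul_eq] at hk
      rw [← hk, mul_neg_one, neg_neg]
  · rintro (rfl | rfl)
    · exact ⟨0, by simp⟩
    · exact ⟨1, by simp⟩

theorem card_unitsModSign {p : ℕ} [Fact p.Prime] (hp : 2 < p) :
    Nat.card (UnitsModSign p) = (p - 1) / 2 := by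
  have h1 := Subgroup.card_eq_card_quotient_mul_card_subgroup (Subgroup.zpowers (-1 : (ZMod p)ˣ))
  have h2 : orderOf (-1 : (ZMod p)ˣ) = 2 := by
    refine orderOf_eq_prime (by simp) ?_
    intro h
    have := Fact.mk hp
    apply ZMod.neg_one_ne_one (n := p)
    simpa using congrArg Units.val h
  rw [Nat.card_zpowers, h2, Nat.card_eq_fintype_card, ZMod.card_units] at h1
  change p - 1 = Nat.card (UnitsModSign p) * 2 at h1
  omega

theorem bijective_of_injective_unitsModSign {p : ℕ} [Fact p.Prime] (hp : 2 < p)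
    {c : Fin ((p - 1) / 2) → UnitsModSign p} (hc : Function.Injective c) :
    Function.Bijective c := by
  have := Finite.of_surjective _ (QuotientGroup.mk_surjective
    (s := Subgroup.zpowers (-1 : (ZMod p)ˣ)))
  have := Fintype.ofFinite (UnitsModSign p)
  rw [Fintype.bijective_iff_injective_and_card]
  refine ⟨hc, ?_⟩
  rw [Fintype.card_fin, ← card_unitsModSign hp, Nat.card_eq_fintype_card]

theorem permutedUpToSign_eisensteinTwist {p : ℕ} [Fact p.Prime] (hp : 2 < p)
    (a : Fin ((p - 1) / 2) → (ZMod p)ˣ)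
    (ha : Function.Injective (fun k => (QuotientGroup.mk (a k) : UnitsModSign p))) :
    PermutedUpToSign p (fun k => eisensteinTwist p (a k))
      (fun k => (QuotientGroup.mk (a k) : UnitsModSign p)) := by
  classical
  have hb := bijective_of_injective_unitsModSign hp ha
  obtain ⟨i₀, hi₀⟩ := hb.2 (QuotientGroup.mk 1)
  have h11 : (1 : (ZMod p)ˣ) ≠ -1 := by
    intro h
    have := Fact.mk hp
    apply ZMod.neg_one_ne_one (n := p)
    simpa using (congrArg Units.val h).symm
  refine permutedUpToSign_of_tendsto hb ?_ (l := UpperHalfPlane.atImInfty) (i₀ := i₀) ?_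
    (tendsto_eisensteinTwist (a i₀)) ?_
  · intro γ i j h
    rw [diamond_eisensteinTwist]
    have h' : (QuotientGroup.mk (a i * lowerRight p γ) : UnitsModSign p)
        = QuotientGroup.mk (a j) := by
      rw [mul_comm]; exact h
    rcases (mk_eq_mk_iff_eq_or_eq_neg _ _).mp h' with h' | h' <;> rw [h']
    · exact Or.inl rfl
    · exact Or.inr (eisensteinTwist_neg _)
  · rcases (mk_eq_mk_iff_eq_or_eq_neg _ _).mp hi₀ with h | h <;> rw [h]
    · simp [h11]
    · simp [h11.symm]
  · intro i hi
    have h : ¬ (a i = 1 ∨ a i = -1) := by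
      rw [← mk_eq_mk_iff_eq_or_eq_neg]
      intro h
      exact hi (ha (h.trans hi₀.symm))
    push Not at h
    simpa [h.1, h.2] using tendsto_eisensteinTwist (a i)

end

/-! ### Quotients of Klein forms -/

section
open Filter Topology Complex

/-- The quotient of level `p` Klein forms with characteristics `(u m / p, 0)`, for `m` in the list
`M` in the numerator and in the list `N` in the denominator. -/
noncomputable def kleinQuotient (p : ℕ) [NeZero p] (M N : List ℕ) (u : ℤ) : ℍ → ℂ :=
  (M.map fun m : ℕ ↦ levelKlein p (u * m)).prod / (N.map fun m : ℕ ↦ levelKlein p (u * m)).prod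

theorem prod_levelKlein_smul {p : ℕ} [NeZero p] (γ : CongruenceSubgroup.Gamma0 p) (M : List ℕ)
    (u : ℤ) (τ : ℍ) :
    (M.map fun m : ℕ ↦ levelKlein p (u * m)).prod ((γ : SL(2, ℤ)) • τ)
        * (((γ : SL(2, ℤ)) 1 0 : ℂ) * τ + (γ : SL(2, ℤ)) 1 1) ^ M.length
      = cexp (Real.pi * I * ((γ : SL(2, ℤ)) 0 1 * u * M.sum
          + (γ : SL(2, ℤ)) 0 0 * (γ : SL(2, ℤ)) 0 1 * u ^ 2 * ((M.map (· ^ 2)).sum : ℕ) / p))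
        * (M.map fun m : ℕ ↦ levelKlein p ((γ : SL(2, ℤ)) 0 0 * u * m)).prod τ := by
  induction M with
  | nil => simp
  | cons m M ih =>
    have h := levelKlein_smul γ (u * m) τ
    rw [← Complex.exp_pi_mul_I, ← Complex.exp_int_mul, ← Complex.exp_add] at h
    simp only [List.map_cons, List.prod_cons, List.length_cons, List.sum_cons, Pi.mul_apply]
    have hE : cexp (Real.pi * I * ((γ : SL(2, ℤ)) 0 1 * u * (m + M.sum : ℕ)
          + (γ : SL(2, ℤ)) 0 0 * (γ : SL(2, ℤ)) 0 1 * u ^ 2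
            * (m ^ 2 + (M.map (· ^ 2)).sum : ℕ) / p))
        = cexp (((γ : SL(2, ℤ)) 0 1 * (u * m) : ℤ) * (Real.pi * I) + Real.pi * I *
            ((γ : SL(2, ℤ)) 0 0 * (γ : SL(2, ℤ)) 0 1 * ((u * m : ℤ) : ℂ) ^ 2 / p))
          * cexp (Real.pi * I * ((γ : SL(2, ℤ)) 0 1 * u * M.sum
          + (γ : SL(2, ℤ)) 0 0 * (γ : SL(2, ℤ)) 0 1 * u ^ 2 * ((M.map (· ^ 2)).sum : ℕ) / p)) := by
      rw [← Complex.exp_add]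
      congr 1
      push_cast
      ring
    rw [hE, mul_mul_mul_comm, ← ih, mul_assoc ((γ : SL(2, ℤ)) 0 0) u, ← h, pow_succ]
    ring

theorem exp_pi_mul_I_mul_int (k : ℤ) :
    cexp (Real.pi * I * k) = 1 ∨ cexp (Real.pi * I * k) = -1 := by
  rw [mul_comm, Complex.exp_int_mul, Complex.exp_pi_mul_I]
  rcases Int.even_or_odd k with h | h
  · exact Or.inl h.neg_one_zpow
  · exact Or.inr h.neg_one_zpow

/-- A quotient of Klein forms of weight one whose characteristics satisfy the quadratic
congruence modulo `p` is mapped by the diamond operators to quotients of the same shape. -/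
theorem diamond_kleinQuotient {p : ℕ} [NeZero p] (γ : CongruenceSubgroup.Gamma0 p)
    {M N : List ℕ} (hlen : N.length = M.length + 1)
    (hsq : (p : ℤ) ∣ ((M.map (· ^ 2)).sum : ℕ) - ((N.map (· ^ 2)).sum : ℕ)) (u : ℤ) :
    diamond γ (kleinQuotient p M N u) = kleinQuotient p M N ((γ : SL(2, ℤ)) 0 0 * u) ∨
    diamond γ (kleinQuotient p M N u) = -kleinQuotient p M N ((γ : SL(2, ℤ)) 0 0 * u) := by
  have hp : (p : ℂ) ≠ 0 := NeZero.ne _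
  obtain ⟨K, hK⟩ := hsq
  set a : ℤ := (γ : SL(2, ℤ)) 0 0 with ha
  set b : ℤ := (γ : SL(2, ℤ)) 0 1 with hb
  have key : ∀ τ, diamond γ (kleinQuotient p M N u) τ
      = cexp (Real.pi * I * (b * u * (M.sum - N.sum) + a * b * u ^ 2 * K : ℤ))
        * kleinQuotient p M N (a * u) τ := by
    intro τ
    have hj := SL2_denom_ne_zero (γ : SL(2, ℤ)) τ
    have hM := prod_levelKlein_smul γ M u τ
    have hN := prod_levelKlein_smul γ N u τ
    rw [← ha, ← hb] at hM hN
    set j := (((γ : SL(2, ℤ)) 1 0 : ℂ) * τ + (γ : SL(2, ℤ)) 1 1) with hj'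
    have hE : cexp (Real.pi * I * (b * u * (M.sum - N.sum) + a * b * u ^ 2 * K : ℤ))
        = cexp (Real.pi * I * (b * u * M.sum + a * b * u ^ 2 * ((M.map (· ^ 2)).sum : ℕ) / p))
          / cexp (Real.pi * I * (b * u * N.sum
              + a * b * u ^ 2 * ((N.map (· ^ 2)).sum : ℕ) / p)) := by
      rw [← Complex.exp_sub]
      congr 1
      have hK' : (((M.map (· ^ 2)).sum : ℕ) : ℂ) - ((N.map (· ^ 2)).sum : ℕ) = p * K := by
        exact_mod_cast hK
      generalize (M.map (· ^ 2)).sum = s at hK' ⊢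
      generalize (N.map (· ^ 2)).sum = t at hK' ⊢
      generalize M.sum = s'
      generalize N.sum = t'
      push_cast
      field_simp
      linear_combination (-(a * b * u ^ 2 : ℂ)) * hK'
    rw [diamond_apply, hE, kleinQuotient, kleinQuotient, Pi.div_apply, Pi.div_apply,
      div_mul_div_comm, ← hM, ← hj', ← hN, hlen, zpow_neg_one]
    have := pow_ne_zero M.length hj
    rw [pow_succ]
    field_simp
  rcases exp_pi_mul_I_mul_int (b * u * (M.sum - N.sum) + a * b * u ^ 2 * K) with h | h
  · left; funext τ; rw [key, h, one_mul]
  · right; funext τ; rw [key, h, neg_one_mul, Pi.neg_apply]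

theorem list_prod_eq_or_eq_neg {R ι : Type*} [CommRing R] {f g : ι → R} (l : List ι)
    (h : ∀ i ∈ l, f i = g i ∨ f i = -g i) :
    (l.map f).prod = (l.map g).prod ∨ (l.map f).prod = -(l.map g).prod := by
  induction l with
  | nil => simp
  | cons i l ih =>
    simp only [List.map_cons, List.prod_cons]
    rcases h i (by simp) with h1 | h1 <;> rcases ih fun i hi ↦ h i (by simp [hi]) with h2 | h2 <;>
      rw [h1, h2] <;> simp

theorem div_eq_or_eq_neg {a b c d : ℍ → ℂ} (h : a = b ∨ a = -b) (h' : c = d ∨ c = -d) :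
    a / c = b / d ∨ a / c = -(b / d) := by
  rcases h with h | h <;> rcases h' with h' | h' <;> rw [h, h'] <;> simp [neg_div, div_neg]

/-- The Klein forms depend on the characteristics only up to sign and modulo `p`, up to sign. -/
theorem kleinQuotient_congr {p : ℕ} [NeZero p] (M N : List ℕ) {u v : ℤ}
    (h : (u : ZMod p) = v ∨ (u : ZMod p) = -v) :
    kleinQuotient p M N u = kleinQuotient p M N v ∨
      kleinQuotient p M N u = -kleinQuotient p M N v := by
  have key : ∀ m : ℕ, levelKlein p (u * m) = levelKlein p (v * m) ∨
      levelKlein p (u * m) = -levelKlein p (v * m) := by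
    intro m
    apply levelKlein_congr
    push_cast
    rcases h with h | h <;> rw [h]
    · exact Or.inl rfl
    · exact Or.inr (neg_mul _ _)
  exact div_eq_or_eq_neg (list_prod_eq_or_eq_neg M fun m _ ↦ key m)
    (list_prod_eq_or_eq_neg N fun m _ ↦ key m)

/-! ### Product expansions -/

theorem qProd_cons (r : ℕ) (l : List ℕ) (N : ℕ) (τ : ℍ) :
    qProd (r :: l) N τ = qPoch (nome τ ^ r) (nome τ ^ N) * qProd l N τ := by
  simp only [qProd, List.map_cons, List.prod_cons, qPoch, pow_add, pow_mul]

theorem qProd_nil (N : ℕ) (τ : ℍ) : qProd [] N τ = 1 := rfl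

theorem norm_nome_pow_lt_one (τ : ℍ) {N : ℕ} (hN : N ≠ 0) : ‖nome τ ^ N‖ < 1 := by
  rw [norm_pow]
  exact pow_lt_one₀ (norm_nonneg _) (norm_nome_lt_one τ) hN

theorem qProd_ne_zero {l : List ℕ} {N : ℕ} (hN : N ≠ 0) (hl : ∀ r ∈ l, r ≠ 0) (τ : ℍ) :
    qProd l N τ ≠ 0 := by
  induction l with
  | nil => simp [qProd_nil]
  | cons r l ih =>
    rw [qProd_cons]
    exact mul_ne_zero (qPoch_ne_zero_of_norm_lt (norm_nome_pow_lt_one τ hN)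
      (norm_nome_pow_lt_one τ (hl r (by simp)))) (ih fun r hr ↦ hl r (by simp [hr]))

theorem tendsto_qProd {l : List ℕ} {N : ℕ} (hN : N ≠ 0) (hl : ∀ r ∈ l, r ≠ 0) :
    Tendsto (qProd l N) UpperHalfPlane.atImInfty (𝓝 1) := by
  have h0 : ∀ {r : ℕ}, r ≠ 0 →
      Tendsto (fun τ ↦ nome τ ^ r) UpperHalfPlane.atImInfty (𝓝 0) := by
    intro r hr
    simpa [hr] using tendsto_nome_atImInfty.pow r
  induction l with
  | nil => exact tendsto_const_nhds
  | cons r l ih =>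
    have h1 : Tendsto (fun τ ↦ qPoch (nome τ ^ r) (nome τ ^ N)) UpperHalfPlane.atImInfty (𝓝 1) := by
      rw [tendsto_iff_norm_sub_tendsto_zero]
      refine squeeze_zero (fun _ ↦ norm_nonneg _)
        (fun τ ↦ norm_qPoch_sub_one_le _ (norm_nome_pow_lt_one τ hN)) ?_
      have h2 := ((h0 (hl r (by simp))).norm.div ((h0 hN).norm.const_sub 1) (by simp)).rexp.sub_const 1
      simpa using h2
    have h2 := h1.mul (ih fun r hr ↦ hl r (by simp [hr]))
    rw [one_mul] at h2
    exact h2.congr fun τ ↦ (qProd_cons r l N τ).symm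

/-- The product expansion of the Klein forms of level `p`. The factor `1 - q^r` missing in the second
Pochhammer symbol of the prime form comes from `exp (π i z) - exp (- π i z)`. -/
theorem levelKlein_mul_qProd {p : ℕ} [NeZero p] {r : ℕ} (hrp : r ≤ p) (τ : ℍ) :
    levelKlein p r τ * qProd [p, p] p τ
      = -cexp (Real.pi * I * (r * (r - p) / p) * τ) * qProd [r, p - r] p τ := by
  have hp : p ≠ 0 := NeZero.ne _
  have hpC : (p : ℂ) ≠ 0 := NeZero.ne _
  have hq := norm_nome_pow_lt_one τ hp
  have e1 : cexp (2 * Real.pi * I * (levelPoint p τ : ℂ)) = nome τ ^ p := by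
    rw [nome, ← Complex.exp_nat_mul, coe_levelPoint]
    congr 1; ring
  have e2 : cexp (2 * Real.pi * I * (r * τ : ℂ)) = nome τ ^ r := by
    rw [nome, ← Complex.exp_nat_mul]
    congr 1; ring
  have e3 : nome τ ^ p * cexp (-(2 * Real.pi * I * (r * τ : ℂ))) = nome τ ^ (p - r) := by
    rw [Complex.exp_neg, e2, pow_sub₀ _ (nome_ne_zero τ) hrp]
  have e4 : (r : ℂ) / p * (levelPoint p τ : ℂ) = r * τ := by
    rw [coe_levelPoint]; field_simp
  have hQ : qPoch (nome τ ^ p) (nome τ ^ p) ≠ 0 := qPoch_self_ne_zero hq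
  have e5 : cexp (Real.pi * I * (r * τ)) - cexp (-(Real.pi * I * (r * τ)))
      = -cexp (-(Real.pi * I * (r * τ))) * (1 - nome τ ^ r) := by
    rw [← e2, neg_mul, mul_sub, ← Complex.exp_add]
    ring_nf
  have e6 : cexp (Real.pi * I * (r * (r - p) / p) * τ)
      = cexp (Real.pi * I * (r / p) * (r * τ)) * cexp (-(Real.pi * I * (r * τ))) := by
    rw [← Complex.exp_add]
    congr 1
    field_simp
    ring
  rw [levelKlein, kleinForm]
  simp only [Matrix.cons_val_zero, Matrix.cons_val_one, add_zero, Int.cast_natCast]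
  rw [e4, primeForm, e1, e2, e3, e5, e6, qProd_cons, qProd_cons, qProd_nil, qProd_cons, qProd_cons,
    qProd_nil, qPoch_eq_mul (nome τ ^ r) hq, mul_comm (nome τ ^ p) (nome τ ^ r)]
  field_simp

/-- The product of `(q^r, q^(p - r); q^p)_∞` over the list `l`. -/
noncomputable def thetaProd (p : ℕ) (l : List ℕ) (τ : ℍ) : ℂ :=
  (l.map fun r ↦ qProd [r, p - r] p τ).prod

theorem qProd_pair_ne_zero {p r : ℕ} (hr : 0 < r) (hrp : r < p) (τ : ℍ) :
    qProd [r, p - r] p τ ≠ 0 :=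
  qProd_ne_zero (by omega) (by simp; omega) τ

theorem thetaProd_ne_zero {p : ℕ} {l : List ℕ} (hl : ∀ r ∈ l, 0 < r ∧ r < p) (τ : ℍ) :
    thetaProd p l τ ≠ 0 := by
  rw [thetaProd, Ne, List.prod_eq_zero_iff, List.mem_map]
  rintro ⟨r, hr, h⟩
  exact qProd_pair_ne_zero (hl r hr).1 (hl r hr).2 τ h

theorem tendsto_thetaProd {p : ℕ} {l : List ℕ} (hl : ∀ r ∈ l, 0 < r ∧ r < p) :
    Tendsto (thetaProd p l) UpperHalfPlane.atImInfty (𝓝 1) := by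
  induction l with
  | nil => exact tendsto_const_nhds
  | cons r l ih =>
    have hr := hl r (by simp)
    have h := (tendsto_qProd (l := [r, p - r]) (N := p) (by omega) (by simp; omega)).mul
      (ih fun r hr ↦ hl r (by simp [hr]))
    rw [one_mul] at h
    exact h

/-- The theta quotient `q^e (q^p; q^p)_∞^2 ∏ (q^m, q^(p - m); q^p)_∞ / ∏ (q^n, q^(p - n); q^p)_∞`,
where `m` runs through `M` and `n` through `N`. -/
noncomputable def thetaMonomial (p : ℕ) (M N : List ℕ) (e : ℕ) (τ : ℍ) : ℂ :=
  nome τ ^ e * (qProd [p, p] p τ * thetaProd p M τ / thetaProd p N τ)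

theorem tendsto_thetaMonomial {p : ℕ} (hp : p ≠ 0) {M N : List ℕ} (hM : ∀ r ∈ M, 0 < r ∧ r < p)
    (hN : ∀ r ∈ N, 0 < r ∧ r < p) (e : ℕ) :
    Tendsto (thetaMonomial p M N e) UpperHalfPlane.atImInfty (𝓝 (0 ^ e)) := by
  have h := (tendsto_nome_atImInfty.pow e).mul
    (((tendsto_qProd (l := [p, p]) hp (by simp [hp])).mul (tendsto_thetaProd hM)).div
      (tendsto_thetaProd hN) one_ne_zero)
  rw [mul_one, div_one, mul_one] at h
  exact h

theorem prod_levelKlein_mul_qProd {p : ℕ} [NeZero p] {M : List ℕ} (hM : ∀ r ∈ M, r ≤ p) (τ : ℍ) :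
    (M.map fun r : ℕ ↦ levelKlein p r).prod τ * qProd [p, p] p τ ^ M.length
      = (-1) ^ M.length * cexp (-(Real.pi * I * (((M.map fun r ↦ r * (p - r)).sum : ℕ) / p) * τ))
        * thetaProd p M τ := by
  induction M with
  | nil => simp [thetaProd]
  | cons r M ih =>
    have hr := hM r (by simp)
    have h := levelKlein_mul_qProd hr τ
    have ih := ih fun r hr ↦ hM r (by simp [hr])
    simp only [List.map_cons, List.prod_cons, List.length_cons, List.sum_cons, Pi.mul_apply,
      thetaProd] at ih ⊢
    generalize (M.map fun r ↦ r * (p - r)).sum = s at ih ⊢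
    have hE : cexp (-(Real.pi * I * ((r * (p - r) + s : ℕ) / p) * τ))
        = cexp (Real.pi * I * (r * (r - p) / p) * τ) * cexp (-(Real.pi * I * (s / p) * τ)) := by
      rw [← Complex.exp_add]
      congr 1
      push_cast [Nat.cast_sub hr]
      ring
    rw [hE, pow_succ, pow_succ]
    linear_combination (M.map fun r : ℕ ↦ levelKlein p r).prod τ * qProd [p, p] p τ ^ M.length * h
      - cexp (Real.pi * I * (r * (r - p) / p) * τ) * qProd [r, p - r] p τ * ih

/-- The exponent `e` is the difference of the values `r (p - r) / (2 p)` of the quadratic polynomial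
governing the leading exponents of the Klein forms. -/
theorem kleinQuotient_one_eq {p : ℕ} [NeZero p] {M N : List ℕ} {e : ℕ}
    (hM : ∀ r ∈ M, r ≤ p) (hN : ∀ r ∈ N, 0 < r ∧ r < p) (hlen : N.length = M.length + 1)
    (he : (N.map fun r ↦ r * (p - r)).sum = (M.map fun r ↦ r * (p - r)).sum + 2 * p * e) :
    kleinQuotient p M N 1 = -thetaMonomial p M N e := by
  funext τ
  have hp : (p : ℂ) ≠ 0 := NeZero.ne _
  have h1 := prod_levelKlein_mul_qProd hM τ
  have h2 := prod_levelKlein_mul_qProd (fun r hr ↦ (hN r hr).2.le) τ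
  have hP : qProd [p, p] p τ ≠ 0 := qProd_ne_zero (NeZero.ne p) (by simp [NeZero.ne p]) τ
  have hT := thetaProd_ne_zero hN τ
  have hE : nome τ ^ e
      * cexp (-(Real.pi * I * (((N.map fun r ↦ r * (p - r)).sum : ℕ) / p) * τ))
      = cexp (-(Real.pi * I * (((M.map fun r ↦ r * (p - r)).sum : ℕ) / p) * τ)) := by
    rw [he, nome, ← Complex.exp_nat_mul, ← Complex.exp_add]
    congr 1
    generalize (M.map fun r ↦ r * (p - r)).sum = s
    push_cast
    field_simp
    ring
  rw [hlen, pow_succ, pow_succ] at h2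
  rw [← hE] at h1
  simp only [kleinQuotient, one_mul, Pi.div_apply, Pi.neg_apply, thetaMonomial]
  have hA := Complex.exp_ne_zero
    (-(Real.pi * I * (((N.map fun r ↦ r * (p - r)).sum : ℕ) / p) * τ))
  generalize cexp (-(Real.pi * I * (((N.map fun r ↦ r * (p - r)).sum : ℕ) / p) * τ)) = A at *
  have hPn := pow_ne_zero M.length hP
  have hs : ((-1 : ℂ)) ^ M.length ≠ 0 := pow_ne_zero _ (by norm_num)
  have hN0 : (N.map fun r : ℕ ↦ levelKlein p r).prod τ ≠ 0 := by
    intro h0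
    rw [h0, zero_mul] at h2
    exact mul_ne_zero (mul_ne_zero (mul_ne_zero hs (by norm_num)) hA) hT h2.symm
  rw [div_eq_iff hN0]
  apply mul_right_cancel₀ hPn
  rw [h1]
  apply mul_right_cancel₀ hP
  field_simp
  linear_combination (nome τ ^ e * thetaProd p M τ) * h2

/-- The representative of `± g` modulo `p` between `0` and `p / 2`. -/
def foldResidue (p g : ℕ) : ℕ := min (g % p) (p - g % p)

theorem foldResidue_pos_lt {p : ℕ} [NeZero p] {g : ℕ} (hg : ¬ p ∣ g) :
    0 < foldResidue p g ∧ foldResidue p g < p := by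
  have h1 := Nat.mod_lt g (NeZero.pos p)
  have h2 : 0 < g % p := Nat.pos_of_ne_zero fun h ↦ hg (Nat.dvd_of_mod_eq_zero h)
  rw [foldResidue]
  omega

theorem eq_or_eq_neg_foldResidue (p : ℕ) [NeZero p] (g : ℕ) :
    (g : ZMod p) = foldResidue p g ∨ (g : ZMod p) = -foldResidue p g := by
  have h1 := Nat.mod_lt g (NeZero.pos p)
  rcases min_choice (g % p) (p - g % p) with h | h <;> rw [foldResidue, h]
  · left; simp
  · right; rw [Nat.cast_sub h1.le]; simp

theorem kleinQuotient_eq_foldResidue (p : ℕ) [NeZero p] (M N : List ℕ) (u : ℕ) :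
    kleinQuotient p M N u = kleinQuotient p (M.map fun m ↦ foldResidue p (u * m))
        (N.map fun m ↦ foldResidue p (u * m)) 1 ∨
      kleinQuotient p M N u = -kleinQuotient p (M.map fun m ↦ foldResidue p (u * m))
        (N.map fun m ↦ foldResidue p (u * m)) 1 := by
  have key : ∀ m : ℕ, levelKlein p ((u : ℤ) * m) = levelKlein p (foldResidue p (u * m)) ∨
      levelKlein p ((u : ℤ) * m) = -levelKlein p (foldResidue p (u * m)) := by
    intro m
    apply levelKlein_congr
    have := eq_or_eq_neg_foldResidue p (u * m)
    push_cast at this ⊢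
    exact this
  simp only [kleinQuotient, one_mul, List.map_map]
  exact div_eq_or_eq_neg (list_prod_eq_or_eq_neg M fun m _ ↦ key m)
    (list_prod_eq_or_eq_neg N fun m _ ↦ key m)

/-- A family of theta quotients is permuted up to sign when its members come from one quotient of
Klein forms by multiplying all characteristics by the integers `u i`, representing
`(ℤ/pℤ)ˣ / {±1}`, and exactly one member has a nonzero constant term. Here `e i` is the leading
exponent of the `i`-th member. The index `i` corresponds to the class of `(u i)⁻¹`, since `⟨γ⟩`
multiplies the characteristics by `γ₁₁ = γ₂₂⁻¹` modulo `p`. -/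
theorem exists_permutedUpToSign {p : ℕ} [Fact p.Prime] (hp : 2 < p)
    {f : Fin ((p - 1) / 2) → ℍ → ℂ} (M N : List ℕ) (u e : Fin ((p - 1) / 2) → ℕ)
    (i₀ : Fin ((p - 1) / 2)) (hlen : N.length = M.length + 1)
    (hsq : (p : ℤ) ∣ ((M.map (· ^ 2)).sum : ℕ) - ((N.map (· ^ 2)).sum : ℕ))
    (hM : ∀ m ∈ M, ¬ p ∣ m) (hN : ∀ m ∈ N, ¬ p ∣ m)
    (hu : ∀ i, 0 < u i ∧ 2 * u i < p) (hinj : ∀ i j, u i = u j → i = j)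
    (he : ∀ i, ((N.map fun m ↦ foldResidue p (u i * m)).map fun r ↦ r * (p - r)).sum
      = ((M.map fun m ↦ foldResidue p (u i * m)).map fun r ↦ r * (p - r)).sum + 2 * p * e i)
    (he₀ : ∀ i, e i = 0 ↔ i = i₀)
    (hf : ∀ i, f i = thetaMonomial p (M.map fun m ↦ foldResidue p (u i * m))
        (N.map fun m ↦ foldResidue p (u i * m)) (e i) ∨
      f i = -thetaMonomial p (M.map fun m ↦ foldResidue p (u i * m))
        (N.map fun m ↦ foldResidue p (u i * m)) (e i)) :
    ∃ c : Fin ((p - 1) / 2) → UnitsModSign p, PermutedUpToSign p f c := by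
  have hpp : p.Prime := Fact.out
  have hundvd : ∀ i, ¬ p ∣ u i := fun i h ↦ by
    have := Nat.le_of_dvd (hu i).1 h
    have := hu i
    omega
  have hu0 : ∀ i, (u i : ZMod p) ≠ 0 := fun i ↦ by
    rw [Ne, ZMod.natCast_eq_zero_iff]; exact hundvd i
  have hrange : ∀ (L : List ℕ), (∀ m ∈ L, ¬ p ∣ m) → ∀ i,
      ∀ r ∈ L.map fun m ↦ foldResidue p (u i * m), 0 < r ∧ r < p := by
    intro L hL i r hr
    obtain ⟨m, hm, rfl⟩ := List.mem_map.mp hr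
    exact foldResidue_pos_lt fun h ↦ (hpp.dvd_mul.mp h).elim (hundvd i) (hL m hm)
  have hfK : ∀ i, f i = kleinQuotient p M N (u i) ∨ f i = -kleinQuotient p M N (u i) := by
    intro i
    have h1 := kleinQuotient_one_eq (fun r hr ↦ (hrange M hM i r hr).2.le) (hrange N hN i)
      (by simpa using hlen) (he i)
    refine eq_or_eq_neg_trans (hf i) (eq_or_eq_neg_symm (eq_or_eq_neg_trans
      (kleinQuotient_eq_foldResidue p M N (u i)) (Or.inr h1)))
  set U : Fin ((p - 1) / 2) → (ZMod p)ˣ := fun i ↦ Units.mk0 (u i) (hu0 i) with hU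
  have hUinj : Function.Injective fun i ↦ (QuotientGroup.mk (U i)⁻¹ : UnitsModSign p) := by
    intro i j hij
    have hi := hu i
    have hj := hu j
    rcases (mk_eq_mk_iff_eq_or_eq_neg _ _).mp hij with h | h
    · have h1 : (u i : ZMod p) = u j := congrArg Units.val (inv_injective h)
      rw [ZMod.natCast_eq_natCast_iff'] at h1
      rw [Nat.mod_eq_of_lt (by omega), Nat.mod_eq_of_lt (by omega)] at h1
      exact hinj i j h1
    · rw [← inv_neg] at h
      have h1 : (u i : ZMod p) = -u j := congrArg Units.val (inv_injective h)
      rw [eq_neg_iff_add_eq_zero, ← Nat.cast_add, ZMod.natCast_eq_zero_iff] at h1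
      have := Nat.le_of_dvd (by omega) h1
      omega
  have hlim : ∀ i, Tendsto (f i) UpperHalfPlane.atImInfty (𝓝 (0 ^ e i)) ∨
      Tendsto (f i) UpperHalfPlane.atImInfty (𝓝 (-0 ^ e i)) := by
    intro i
    have h := tendsto_thetaMonomial hpp.ne_zero (hrange M hM i) (hrange N hN i) (e i)
    rcases hf i with h1 | h1 <;> rw [h1]
    · exact Or.inl h
    · exact Or.inr h.neg
  have hlim₀ : ∃ a : ℂ, a ≠ 0 ∧ Tendsto (f i₀) UpperHalfPlane.atImInfty (𝓝 a) := by
    have h := hlim i₀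
    rw [(he₀ i₀).mpr rfl, pow_zero] at h
    rcases h with h | h
    · exact ⟨1, one_ne_zero, h⟩
    · exact ⟨-1, by norm_num, h⟩
  obtain ⟨a, ha, h₀⟩ := hlim₀
  refine ⟨fun i ↦ QuotientGroup.mk (U i)⁻¹, permutedUpToSign_of_tendsto
    (bijective_of_injective_unitsModSign hp hUinj) ?_ ha h₀ fun i hi ↦ ?_⟩
  · intro γ i j h
    have h' : (QuotientGroup.mk (lowerRight p γ * (U i)⁻¹) : UnitsModSign p)
        = QuotientGroup.mk (U j)⁻¹ := h
    have had := upperLeft_mul_lowerRight γ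
    have hdiv : ∀ V : (ZMod p)ˣ, lowerRight p γ * (U i)⁻¹ = V⁻¹ →
        (((γ : SL(2, ℤ)) 0 0 * u i : ℤ) : ZMod p) = V := by
      intro V hV
      rw [mul_inv_eq_iff_eq_mul, eq_inv_mul_iff_mul_eq] at hV
      have h1 : (V : ZMod p) * (((γ : SL(2, ℤ)) 1 1 : ℤ) : ZMod p) = u i := congrArg Units.val hV
      rw [Int.cast_mul, Int.cast_natCast, ← h1]
      linear_combination (V : ZMod p) * had
    have h2 : (((γ : SL(2, ℤ)) 0 0 * u i : ℤ) : ZMod p) = (u j : ℤ) ∨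
        (((γ : SL(2, ℤ)) 0 0 * u i : ℤ) : ZMod p) = -(u j : ℤ) := by
      rw [Int.cast_natCast]
      rcases (mk_eq_mk_iff_eq_or_eq_neg _ _).mp h' with h' | h'
      · exact Or.inl (hdiv (U j) h')
      · rw [← inv_neg] at h'
        exact Or.inr (hdiv (-U j) h')
    exact eq_or_eq_neg_trans (diamond_congr γ (hfK i)) (eq_or_eq_neg_trans
      (diamond_kleinQuotient γ hlen hsq (u i)) (eq_or_eq_neg_trans
        (kleinQuotient_congr M N h2) (eq_or_eq_neg_symm (hfK j))))
  · have h := hlim i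
    rw [zero_pow fun h ↦ hi ((he₀ i).mp h), neg_zero, or_self] at h
    exact h

end

/-! ### The theta quotients of level `p ≤ 19` -/

section

/-- Dissection of `(a; q)_∞` by the residue classes of the exponents modulo `N`. -/
theorem qPoch_eq_prod_qPoch_pow (N : ℕ) [NeZero N] (a : ℂ) {q : ℂ} (hq : ‖q‖ < 1) :
    qPoch a q = ∏ i : Fin N, qPoch (a * q ^ (i : ℕ)) (q ^ N) := by
  have hqN : ‖q ^ N‖ < 1 := by
    rw [norm_pow]
    exact pow_lt_one₀ (norm_nonneg _) hq (NeZero.ne N)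
  have hm : Multipliable fun x : ℕ × Fin N ↦ 1 - a * q ^ (x.2 : ℕ) * (q ^ N) ^ x.1 := by
    have := (Nat.divModEquiv N).symm.multipliable_iff.mpr (multipliable_qPoch a hq)
    refine this.congr fun x ↦ ?_
    simp only [Function.comp_apply, Nat.divModEquiv_symm_apply]
    rw [pow_add, ← pow_mul, mul_comm N]
    ring
  calc qPoch a q = ∏' x : ℕ × Fin N, (1 - a * q ^ (x.2 : ℕ) * (q ^ N) ^ x.1) := by
        rw [qPoch, ← (Nat.divModEquiv N).symm.tprod_eq]
        refine tprod_congr fun x ↦ ?_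
        simp only [Nat.divModEquiv_symm_apply]
        rw [pow_add, ← pow_mul, mul_comm N]
        ring
    _ = ∏' m : ℕ, ∏ i : Fin N, (1 - a * q ^ (i : ℕ) * (q ^ N) ^ m) := by
        rw [hm.tprod_prod' fun m ↦ (hasProd_fintype _).multipliable]
        simp only [tprod_fintype]
    _ = _ := Multipliable.tprod_finsetProd fun i _ ↦ multipliable_qPoch _ hqN

theorem qPoch_nome_eq_qProd_five (τ : ℍ) :
    qPoch (nome τ) (nome τ) = qProd [1, 2, 3, 4, 5] 5 τ := by
  rw [qPoch_eq_prod_qPoch_pow 5 _ (norm_nome_lt_one τ), Fin.prod_univ_five]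
  simp only [qProd_cons, qProd_nil, ← pow_succ', mul_one, mul_assoc]
  rfl

theorem exists_permutedUpToSign_five [Fact (Nat.Prime 5)] :
    ∃ c : Fin ((5 - 1) / 2) → UnitsModSign 5, PermutedUpToSign 5 (thetaQuotient 5) c := by
  refine exists_permutedUpToSign (by decide) [2, 2] [1, 1, 1] ![2, 1]
    ![1, 0] 1 rfl
    (by decide) (by decide) (by decide) (by decide) (by decide) (by decide) (by decide) ?_
  intro i
  left
  funext τ
  have h14 : qProd [1, 4] 5 τ ≠ 0 := qProd_ne_zero (by decide) (by decide) τ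
  have h23 : qProd [2, 3] 5 τ ≠ 0 := qProd_ne_zero (by decide) (by decide) τ
  -- the numerator `(q; q)_∞²` is not yet of level `5`: split its exponents by residues modulo `5`
  have hη : qProd [1, 1] 1 τ = qProd [5, 5] 5 τ * qProd [1, 4] 5 τ ^ 2 * qProd [2, 3] 5 τ ^ 2 := by
    simp only [qProd_cons _ _ 1, qProd_nil, pow_one, qPoch_nome_eq_qProd_five]
    simp only [qProd_cons, qProd_nil]
    ring
  fin_cases i
  · simp [thetaQuotient, thetaMonomial, thetaProd, foldResidue, hη]
    field_simp
  · simp [thetaQuotient, thetaMonomial, thetaProd, foldResidue, hη]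
    field_simp

theorem exists_permutedUpToSign_seven [Fact (Nat.Prime 7)] :
    ∃ c : Fin ((7 - 1) / 2) → UnitsModSign 7, PermutedUpToSign 7 (thetaQuotient 7) c := by
  refine exists_permutedUpToSign (by decide) [3] [1, 1] ![3, 2, 1]
    ![1, 1, 0] 2 rfl
    (by decide) (by decide) (by decide) (by decide) (by decide) (by decide) (by decide) ?_
  intro i
  fin_cases i
  -- the second quotient carries a minus sign
  on_goal 2 => right
  on_goal 1 => left
  on_goal 3 => left
  all_goals
    funext τ
    simp [thetaQuotient, thetaMonomial, thetaProd, foldResidue, qProd_cons, qProd_nil]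
    ring

theorem exists_permutedUpToSign_eleven [Fact (Nat.Prime 11)] :
    ∃ c : Fin ((11 - 1) / 2) → UnitsModSign 11, PermutedUpToSign 11 (thetaQuotient 11) c := by
  refine exists_permutedUpToSign (by decide) [4] [1, 2] ![1, 4, 3, 2, 5]
    ![0, 1, 2, 1, 1] 0 rfl
    (by decide) (by decide) (by decide) (by decide) (by decide) (by decide) (by decide) ?_
  intro i
  left
  funext τ
  fin_cases i <;>
    simp [thetaQuotient, thetaMonomial, thetaProd, foldResidue, qProd_cons, qProd_nil] <;> ring

theorem exists_permutedUpToSign_thirteen [Fact (Nat.Prime 13)] :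
    ∃ c : Fin ((13 - 1) / 2) → UnitsModSign 13, PermutedUpToSign 13 (thetaQuotient 13) c := by
  refine exists_permutedUpToSign (by decide) [6] [1, 3] ![1, 3, 4, 5, 6, 2]
    ![0, 1, 1, 1, 2, 2] 0 rfl
    (by decide) (by decide) (by decide) (by decide) (by decide) (by decide) (by decide) ?_
  intro i
  left
  funext τ
  fin_cases i <;>
    simp [thetaQuotient, thetaMonomial, thetaProd, foldResidue, qProd_cons, qProd_nil] <;> ring

theorem exists_permutedUpToSign_seventeen [Fact (Nat.Prime 17)] :
    ∃ c : Fin ((17 - 1) / 2) → UnitsModSign 17, PermutedUpToSign 17 (thetaQuotient 17) c := by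
  refine exists_permutedUpToSign (by decide) [8] [2, 3] ![1, 7, 2, 3, 4, 6, 8, 5]
    ![0, 1, 3, 2, 3, 1, 1, 1] 0 rfl
    (by decide) (by decide) (by decide) (by decide) (by decide) (by decide) (by decide) ?_
  intro i
  left
  funext τ
  fin_cases i <;>
    simp [thetaQuotient, thetaMonomial, thetaProd, foldResidue, qProd_cons, qProd_nil] <;> ring

theorem exists_permutedUpToSign_nineteen [Fact (Nat.Prime 19)] :
    ∃ c : Fin ((19 - 1) / 2) → UnitsModSign 19, PermutedUpToSign 19 (thetaQuotient 19) c := by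
  refine exists_permutedUpToSign (by decide) [8, 9] [3, 4, 5] ![1, 5, 6, 8, 2, 9, 7, 3, 4]
    ![0, 1, 1, 1, 5, 2, 2, 2, 1] 0 rfl
    (by decide) (by decide) (by decide) (by decide) (by decide) (by decide) (by decide) ?_
  intro i
  left
  funext τ
  fin_cases i <;>
    simp [thetaQuotient, thetaMonomial, thetaProd, foldResidue, qProd_cons, qProd_nil] <;> ring

theorem exists_permutedUpToSign_thetaQuotient (p : ℕ) [hp : Fact p.Prime] (h5 : 5 ≤ p)
    (h19 : p ≤ 19) :
    ∃ c : Fin ((p - 1) / 2) → UnitsModSign p, PermutedUpToSign p (thetaQuotient p) c := by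
  have hpp := hp.out
  have hcases : p = 5 ∨ p = 7 ∨ p = 11 ∨ p = 13 ∨ p = 17 ∨ p = 19 := by
    interval_cases p <;> first | (norm_num at hpp; done) | simp
  rcases hcases with rfl | rfl | rfl | rfl | rfl | rfl
  · exact exists_permutedUpToSign_five
  · exact exists_permutedUpToSign_seven
  · exact exists_permutedUpToSign_eleven
  · exact exists_permutedUpToSign_thirteen
  · exact exists_permutedUpToSign_seventeen
  · exact exists_permutedUpToSign_nineteen

end

theorem mainTheorem4 (p : ℕ) [Fact p.Prime] (h5 : 5 ≤ p) (h19 : p ≤ 19) :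
    (∀ γ γ' : CongruenceSubgroup.Gamma0 p, lowerRight p γ = lowerRight p γ' →
      diamond γ (eisensteinSum p) = diamond γ' (eisensteinSum p)) ∧
    (∀ (a : Fin ((p - 1) / 2) → (ZMod p)ˣ) (δ : Fin ((p - 1) / 2) → CongruenceSubgroup.Gamma0 p),
      Function.Injective (fun k => (QuotientGroup.mk (a k) : UnitsModSign p)) →
      (∀ k, lowerRight p (δ k) = a k) →
      PermutedUpToSign p (fun k => diamond (δ k) (eisensteinSum p))
        (fun k => (QuotientGroup.mk (a k) : UnitsModSign p))) ∧
    (∃ c : Fin ((p - 1) / 2) → UnitsModSign p, PermutedUpToSign p (thetaQuotient p) c) := by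
  have hp2 : 2 < p := by omega
  refine ⟨fun γ γ' h ↦ ?_, fun a δ ha hδ ↦ ?_, exists_permutedUpToSign_thetaQuotient p h5 h19⟩
  · rw [diamond_eisensteinSum, diamond_eisensteinSum, h]
  · simp only [diamond_eisensteinSum, hδ]
    exact permutedUpToSign_eisensteinTwist hp2 a ha
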